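/- Let $\mathbb H$ be the quaternions and $\mathbb S=\{q\in\mathbb H: q^2=-1\}$; for $I\in\mathbb S$ put $L_I=\mathbb R+I\mathbb R$. A symmetric slice domain is a domain $\Omega\subseteq\mathbb H$ that meets the real axis, such that $\Omega\cap L_I$ is a domain in $L_I\simeq\mathbb C$ for every $I\in\mathbb S$, and such that $x+y\mathbb S\subset\Omega$ whenever $x+yI\in\Omega$ with $x,y\in\mathbb R$, $I\in\mathbb S$. A function $f:\Omega\to\mathbb H$ is (slice) regular if for every $I\in\mathbb S$ the restriction $f_I=f|_{\Omega\cap L_I}$ is holomorphic, i.e. real differentiable with $\frac12\left(\frac{\partial}{\partial x}+I\frac{\partial}{\partial y}\right)f_I(x+Iy)=0$. A regular $f$ on a symmetric slice domain has the form $f(x+Iy)=\alpha(x,y)+I\beta(x,y)$ with $\alpha,\beta$ independent of $I\in\mathbb S$, where $\alpha$ is even and $\beta$ is odd in $y$; if also $g(x+Iy)=\gamma+I\delta$, the regular product is $(f*g)(x+Iy)=(\alpha\gamma-\beta\delta)+I(\alpha\delta+\beta\gamma)$. For $p\in\Omega$, $R_pf:\Omega\to\mathbb H$ denotes the unique regular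 function with $$f(q)=f(p)+(q-p)*R_pf(q)\qquad(q\in\Omega).$$ Let $x_0,y_0\in\mathbb R$, $R>0$ and $$U=U(x_0+y_0\mathbb S,R)=\{q\in\mathbb H: |(q-x_0)^2+y_0^2|<R^2\}.$$ Then there exists a constant $C>0$, depending only on $U$, with the following property. Let $f$ be a regular function on a symmetric slice domain $\Omega$ with $x_0+y_0\mathbb S\subset\Omega$ and $\overline U\subset\Omega$, and let $q_0\in x_0+y_0\mathbb S$. Then the functions $(R_{\bar q_0}R_{q_0})^nf$ and $R_{q_0}(R_{\bar q_0}R_{q_0})^nf$ exist for all $n\in\mathbb N$, $|f|$ attains a maximum on $\partial U$, and the coefficients $$A_{2n}=(R_{\bar q_0}R_{q_0})^nf(q_0),\qquad A_{2n+1}=R_{q_0}(R_{\bar q_0}R_{q_0})^nf(\bar q_0)$$ satisfy $$|A_n|\le C\cdot\frac{\max_{\partial U}|f|}{R^n}\qquad\text{for all } n\in\mathbb N=\{0,1,2,\dots\}.$$ -/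

import Mathlib

open scoped Quaternion

noncomputable section

namespace SliceRegular

/-- The sphere `𝕊` of quaternionic imaginary units. -/
def imagUnits : Set ℍ[ℝ] := {I | I ^ 2 = -1}

/-- The parametrization `x + i y ↦ x + y I` of the slice `L_I = ℝ + I ℝ` by the complex plane. -/
def slicePoint (I : ℍ[ℝ]) (z : ℂ) : ℍ[ℝ] := (z.re : ℍ[ℝ]) + (z.im : ℍ[ℝ]) * I

/-- The set `x₀ + y₀ 𝕊` (a 2-sphere, or a real point if `y₀ = 0`). -/
def unitSphere (x₀ y₀ : ℝ) : Set ℍ[ℝ] :=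
  {q | ∃ I ∈ imagUnits, q = (x₀ : ℍ[ℝ]) + (y₀ : ℍ[ℝ]) * I}

/-- A slice domain: a domain of `ℍ` that meets the real axis and whose intersection with each
`L_I ≃ ℂ` is a domain of `L_I` (openness in `L_I` is automatic). -/
structure IsSliceDomain (Ω : Set ℍ[ℝ]) : Prop where
  isOpen : IsOpen Ω
  isConnected : IsConnected Ω
  meets_real : ∃ x : ℝ, (x : ℍ[ℝ]) ∈ Ω
  isConnected_slice : ∀ I ∈ imagUnits, IsConnected (slicePoint I ⁻¹' Ω)

/-- Axial symmetry: `Ω` contains `x + y 𝕊` whenever it contains a point `x + y I`. -/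
def IsAxiallySymmetric (Ω : Set ℍ[ℝ]) : Prop :=
  ∀ (x y : ℝ), ∀ I ∈ imagUnits, (x : ℍ[ℝ]) + (y : ℍ[ℝ]) * I ∈ Ω → unitSphere x y ⊆ Ω

structure IsSymmetricSliceDomain (Ω : Set ℍ[ℝ]) : Prop extends IsSliceDomain Ω where
  symmetric : IsAxiallySymmetric Ω

/-- Slice regularity on (an open set) `Ω`: for each `I ∈ 𝕊` the restriction `f_I` to `Ω ∩ L_I` is
holomorphic, that is, differentiable in the two real variables `x, y` with
`(1/2) (∂/∂x + I ∂/∂y) f_I (x + y I) = 0`. Only the values of `f` on `Ω` matter. -/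
def IsRegularOn (f : ℍ[ℝ] → ℍ[ℝ]) (Ω : Set ℍ[ℝ]) : Prop :=
  ∀ I ∈ imagUnits, ∀ z : ℂ, slicePoint I z ∈ Ω →
    DifferentiableAt ℝ (fun w : ℂ => f (slicePoint I w)) z ∧
    (1 / 2 : ℝ) • (fderiv ℝ (fun w : ℂ => f (slicePoint I w)) z 1
      + I * fderiv ℝ (fun w : ℂ => f (slicePoint I w)) z Complex.I) = 0

/-- The unit `I` with `q = x + y I`, `y = |Im q| > 0` (and `0` if `q` is real). -/
def imagUnit (q : ℍ[ℝ]) : ℍ[ℝ] := (‖q.im‖⁻¹ : ℝ) • q.im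

/-- The component `α` of `f (x + y I) = α (x, y) + I β (x, y)`. -/
def stemRe (f : ℍ[ℝ] → ℍ[ℝ]) (q : ℍ[ℝ]) : ℍ[ℝ] := (1 / 2 : ℝ) • (f q + f (star q))

/-- The component `β` of `f (x + y I) = α (x, y) + I β (x, y)`. -/
def stemIm (f : ℍ[ℝ] → ℍ[ℝ]) (q : ℍ[ℝ]) : ℍ[ℝ] :=
  -((1 / 2 : ℝ) • (imagUnit q * (f q - f (star q))))

/-- The regular product `f * g` on a symmetric slice domain: if `f (x + y I) = α + I β` and
`g (x + y I) = γ + I δ`, where `α, β, γ, δ` depend on `x, y` only, then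
`(f * g) (x + y I) = (α γ - β δ) + I (α δ + β γ)`. It extends the product of power series
`(∑ qⁿ aₙ) * (∑ qⁿ bₙ) = ∑ qⁿ ∑ₖ aₖ bₙ₋ₖ`. -/
def regularMul (f g : ℍ[ℝ] → ℍ[ℝ]) (q : ℍ[ℝ]) : ℍ[ℝ] :=
  (stemRe f q * stemRe g q - stemIm f q * stemIm g q)
    + imagUnit q * (stemRe f q * stemIm g q + stemIm f q * stemRe g q)

/-- `g` is the regular function on `Ω` with `f(q) = f(p) + (q - p) * g(q)` on `Ω`; for `f` regular
on a symmetric slice domain and `p ∈ Ω` it exists and its values on `Ω` are unique. -/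
def IsRemainder (Ω : Set ℍ[ℝ]) (p : ℍ[ℝ]) (f g : ℍ[ℝ] → ℍ[ℝ]) : Prop :=
  IsRegularOn g Ω ∧ ∀ q ∈ Ω, f q = f p + regularMul (fun s => s - p) g q

open Classical in
/-- The function `R_p f` on `Ω`. -/
def remainder (Ω : Set ℍ[ℝ]) (p : ℍ[ℝ]) (f : ℍ[ℝ] → ℍ[ℝ]) : ℍ[ℝ] → ℍ[ℝ] :=
  if h : ∃ g, IsRemainder Ω p f g then Classical.choose h else 0

/-- The iterate `(R_{q̄₀} R_{q₀})ⁿ f`. -/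
def remainderIter (Ω : Set ℍ[ℝ]) (q₀ : ℍ[ℝ]) (f : ℍ[ℝ] → ℍ[ℝ]) (n : ℕ) : ℍ[ℝ] → ℍ[ℝ] :=
  (fun g => remainder Ω (star q₀) (remainder Ω q₀ g))^[n] f

/-- The coefficients `A₂ₙ = (R_{q̄₀} R_{q₀})ⁿ f (q₀)`, `A₂ₙ₊₁ = R_{q₀} (R_{q̄₀} R_{q₀})ⁿ f (q̄₀)`. -/
def coeff (Ω : Set ℍ[ℝ]) (q₀ : ℍ[ℝ]) (f : ℍ[ℝ] → ℍ[ℝ]) (n : ℕ) : ℍ[ℝ] :=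
  if Even n then remainderIter Ω q₀ f (n / 2) q₀
  else remainder Ω q₀ (remainderIter Ω q₀ f (n / 2)) (star q₀)

/-- `U(x₀ + y₀ 𝕊, R) = {q | |(q - x₀)² + y₀²| < R²}`. -/
def lemniscateNhd (x₀ y₀ R : ℝ) : Set ℍ[ℝ] :=
  {q | ‖(q - (x₀ : ℍ[ℝ])) ^ 2 + (y₀ : ℍ[ℝ]) ^ 2‖ < R ^ 2}

end SliceRegular

end

noncomputable section

namespace SliceRegular


/-! ### Slices -/

/-! Everything takes place on one slice `L_I` through `q₀`. Under left multiplication by `L_I ≃ ℂ`,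
the quaternions form a complex Banach space (`LeftSlice`), and regularity says that each restriction
is holomorphic with values in it. On this slice the regular product with `q - q₀` or `q - q̄₀` is
pointwise, so remainders are difference quotients (`dslope`). The representation formula
(`IsRegularOn.slicePoint_eq`), a consequence of the identity theorem, extends them to `Ω`.

Dividing twice gives, for the restriction `φₙ` of the `n`-th iterate, `φₙ(z) = A₂ₙ + (z - z₀) A₂ₙ₊₁
+ ((z - x₀)² + y₀²) φₙ₊₁(z)`. Put `s = z - x₀`. The even part of `φₙ` in `s`, and the odd part
divided by `s`, are even in `s`, hence holomorphic functions of `w = s² + y₀²` on `|w| ≤ R²`. The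
recurrence makes `A₂ₙ - y₀ I A₂ₙ₊₁` and `A₂ₙ₊₁` their Taylor coefficients at `w = 0`, and Cauchy's
estimate on `|w| = R²` bounds them (`norm_lemniscate_coeff_le`). Passing to `w` treats every shape
of the lemniscate at once.

Dividing by `s` costs `|w - y₀²|^(-1/2)`, which is unbounded on the circle if `|y₀| = R`. It is at
most `(R² |sin θ|)^(-1/2)`, which is integrable; hence Cauchy's estimate is used with a mean over
the circle. -/

theorem imagUnits_mul_self {I : ℍ[ℝ]} (hI : I ∈ imagUnits) : I * I = -1 := by
  rw [← sq]; exact hI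

theorem imagUnits_re {I : ℍ[ℝ]} (hI : I ∈ imagUnits) : I.re = 0 := by
  have h := imagUnits_mul_self hI
  have h0 := congrArg (fun q : ℍ[ℝ] => q.re) h
  have h1 := congrArg (fun q : ℍ[ℝ] => q.imI) h
  have h2 := congrArg (fun q : ℍ[ℝ] => q.imJ) h
  have h3 := congrArg (fun q : ℍ[ℝ] => q.imK) h
  simp at h0 h1 h2 h3
  by_contra hne
  have e1 : I.imI = 0 := by
    have : I.re * I.imI = 0 := by linarith
    simpa [hne] using this
  have e2 : I.imJ = 0 := by
    have : I.re * I.imJ = 0 := by linarith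
    simpa [hne] using this
  have e3 : I.imK = 0 := by
    have : I.re * I.imK = 0 := by linarith
    simpa [hne] using this
  rw [e1, e2, e3] at h0
  nlinarith [sq_nonneg I.re]

theorem star_imagUnits {I : ℍ[ℝ]} (hI : I ∈ imagUnits) : star I = -I := by
  have := imagUnits_re hI
  ext <;> simp [this]

theorem norm_imagUnits {I : ℍ[ℝ]} (hI : I ∈ imagUnits) : ‖I‖ = 1 := by
  have h : ‖I‖ * ‖I‖ = 1 := by
    rw [← norm_mul, imagUnits_mul_self hI]; simp
  nlinarith [norm_nonneg I]

theorem neg_mem_imagUnits {I : ℍ[ℝ]} (hI : I ∈ imagUnits) : -I ∈ imagUnits := by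
  change (-I) ^ 2 = -1
  rw [neg_sq]; exact hI

/-- The embedding of `ℂ` onto the slice `L_I`, as a homomorphism of real algebras. -/
def sliceHom (I : imagUnits) : ℂ →ₐ[ℝ] ℍ[ℝ] :=
  Complex.liftAux (I : ℍ[ℝ]) (imagUnits_mul_self I.2)

theorem sliceHom_apply (I : imagUnits) (z : ℂ) : sliceHom I z = slicePoint I z := by
  rw [sliceHom, Complex.liftAux_apply, slicePoint, Quaternion.coe_mul_eq_smul]
  rfl

theorem norm_slicePoint {I : ℍ[ℝ]} (hI : I ∈ imagUnits) (z : ℂ) : ‖slicePoint I z‖ = ‖z‖ := by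
  have h : slicePoint I z * star (slicePoint I z) = ((z.re ^ 2 + z.im ^ 2 : ℝ) : ℍ[ℝ]) := by
    have hs : star (slicePoint I z) = slicePoint I (star z) := by
      simp [slicePoint, star_imagUnits hI, Quaternion.coe_mul_eq_smul]
    rw [hs]
    have := (map_mul (sliceHom ⟨I, hI⟩) z (star z)).symm
    rw [sliceHom_apply, sliceHom_apply] at this
    rw [this, Complex.star_def, Complex.mul_conj, sliceHom_apply]
    simp [slicePoint, Complex.normSq_apply, sq]
  have h2 : ‖slicePoint I z‖ * ‖slicePoint I z‖ = z.re ^ 2 + z.im ^ 2 := by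
    have := congrArg norm h
    rw [norm_mul, norm_star, Quaternion.norm_coe, Real.norm_of_nonneg (by positivity)] at this
    exact this
  have h3 : ‖z‖ * ‖z‖ = z.re ^ 2 + z.im ^ 2 := by
    rw [← sq, Complex.sq_norm, Complex.normSq_apply]; ring
  exact (mul_self_inj (norm_nonneg _) (norm_nonneg _)).1 (h2.trans h3.symm)

theorem slicePoint_ofReal (I : ℍ[ℝ]) (x : ℝ) : slicePoint I (x : ℂ) = (x : ℍ[ℝ]) := by
  simp [slicePoint]

theorem slicePoint_conj (I : ℍ[ℝ]) (z : ℂ) : slicePoint I (star z) = slicePoint (-I) z := by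
  simp [slicePoint]

theorem star_slicePoint {I : ℍ[ℝ]} (hI : I ∈ imagUnits) (z : ℂ) :
    star (slicePoint I z) = slicePoint I (star z) := by
  simp [slicePoint, star_imagUnits hI, Quaternion.coe_mul_eq_smul]

theorem continuous_slicePoint (I : ℍ[ℝ]) : Continuous (slicePoint I) := by
  have h : Continuous fun x : ℝ => (x : ℍ[ℝ]) := Quaternion.continuous_coe
  exact (h.comp Complex.continuous_re).add ((h.comp Complex.continuous_im).mul continuous_const)

theorem IsAxiallySymmetric.slicePoint_mem {Ω : Set ℍ[ℝ]} (hΩ : IsAxiallySymmetric Ω)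
    {I J : ℍ[ℝ]} (hI : I ∈ imagUnits) (hJ : J ∈ imagUnits) {z : ℂ} (hz : slicePoint I z ∈ Ω) :
    slicePoint J z ∈ Ω :=
  hΩ z.re z.im I hI hz ⟨J, hJ, rfl⟩

theorem IsAxiallySymmetric.star_mem {Ω : Set ℍ[ℝ]} (hΩ : IsAxiallySymmetric Ω)
    {I : ℍ[ℝ]} (hI : I ∈ imagUnits) {z : ℂ} (hz : slicePoint I z ∈ Ω) :
    slicePoint I (star z) ∈ Ω := by
  rw [slicePoint_conj]
  exact hΩ.slicePoint_mem hI (neg_mem_imagUnits hI) hz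

/-- The quaternions, with `ℂ` acting by left multiplication through the slice `L_I`. -/
def LeftSlice (_ : imagUnits) : Type := ℍ[ℝ]

namespace LeftSlice

variable (I : imagUnits)

instance : NormedAddCommGroup (LeftSlice I) := inferInstanceAs (NormedAddCommGroup ℍ[ℝ])

instance : CompleteSpace (LeftSlice I) := inferInstanceAs (CompleteSpace ℍ[ℝ])

/-- The identity map, from the quaternions to `LeftSlice I`. -/
def mk (q : ℍ[ℝ]) : LeftSlice I := q

variable {I} in
/-- The identity map, from `LeftSlice I` to the quaternions. -/
def val (q : LeftSlice I) : ℍ[ℝ] := q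

/-- This structure turns the condition `(∂ₓ + I ∂ᵧ) f = 0` into complex differentiability, so that
Banach-valued complex analysis applies. -/
instance : NormedSpace ℂ (LeftSlice I) where
  smul z q := mk I (sliceHom I z * q.val)
  one_smul q := by
    change sliceHom I 1 * q.val = q.val
    rw [map_one, one_mul]
  mul_smul z w q := by
    change sliceHom I (z * w) * q.val = sliceHom I z * (sliceHom I w * q.val)
    rw [map_mul, mul_assoc]
  smul_zero z := mul_zero (sliceHom I z)
  smul_add z q r := mul_add (sliceHom I z) q.val r.val
  add_smul z w q := by
    change sliceHom I (z + w) * q.val = sliceHom I z * q.val + sliceHom I w * q.val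
    rw [map_add, add_mul]
  zero_smul q := by
    change sliceHom I 0 * q.val = 0
    rw [map_zero, zero_mul]
  norm_smul_le z q := by
    change ‖sliceHom I z * q.val‖ ≤ ‖z‖ * ‖q.val‖
    rw [norm_mul, sliceHom_apply, norm_slicePoint I.2]

variable {I}

theorem smul_def (z : ℂ) (q : ℍ[ℝ]) : z • mk I q = mk I (slicePoint I z * q) := by
  rw [← sliceHom_apply]; rfl

end LeftSlice

theorem slicePoint_I (I : ℍ[ℝ]) : slicePoint I Complex.I = I := by
  simp [slicePoint]

/-- The restriction of `f` to the slice `L_I`, with values in the complex vector space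
`LeftSlice I`. -/
def restrict (I : imagUnits) (f : ℍ[ℝ] → ℍ[ℝ]) (z : ℂ) : LeftSlice I :=
  LeftSlice.mk I (f (slicePoint I z))

theorem differentiableAt_leftSlice_iff (I : imagUnits) (h : ℂ → ℍ[ℝ]) (z : ℂ) :
    DifferentiableAt ℂ (fun w => LeftSlice.mk I (h w)) z ↔ DifferentiableAt ℝ h z ∧
      (1 / 2 : ℝ) • (fderiv ℝ h z 1 + I * fderiv ℝ h z Complex.I) = 0 := by
  have hI := imagUnits_mul_self I.2
  rw [smul_eq_zero_iff_right (by norm_num)]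
  constructor
  · intro hd
    obtain ⟨d, hd⟩ : ∃ d : ℍ[ℝ], HasDerivAt (fun w => LeftSlice.mk I (h w)) (LeftSlice.mk I d) z :=
      ⟨_, hd.hasDerivAt⟩
    let L : ℂ →L[ℝ] ℍ[ℝ] := LinearMap.toContinuousLinearMap
      ((LinearMap.mulRight ℝ d) ∘ₗ (sliceHom I).toLinearMap)
    have hL (v : ℂ) : L v = slicePoint I v * d := by
      rw [← sliceHom_apply]; rfl
    have hf : HasFDerivAt h L z := by
      rw [hasFDerivAt_iff_isLittleO]
      refine (hasDerivAt_iff_isLittleO.1 hd).congr_left fun w => ?_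
      rw [hL, LeftSlice.smul_def]; rfl
    refine ⟨hf.differentiableAt, ?_⟩
    rw [hf.fderiv, hL, hL, slicePoint_I, ← mul_assoc, hI]
    simp [slicePoint]
  · rintro ⟨hd, e⟩
    -- The Cauchy–Riemann equation says exactly that the real differential is complex linear.
    have key (v : ℂ) : fderiv ℝ h z v = slicePoint I v * fderiv ℝ h z 1 := by
      have e' : fderiv ℝ h z Complex.I = I * fderiv ℝ h z 1 := by
        rw [eq_neg_of_add_eq_zero_left e, mul_neg, ← mul_assoc, hI]; simp
      have hv : v = v.re • (1 : ℂ) + v.im • Complex.I := by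
        apply Complex.ext <;> simp
      conv_lhs => rw [hv]
      rw [map_add, map_smul, map_smul, e', slicePoint, add_mul, Quaternion.coe_mul_eq_smul,
        Quaternion.coe_mul_eq_smul, smul_mul_assoc]
    have : HasDerivAt (fun w => LeftSlice.mk I (h w)) (LeftSlice.mk I (fderiv ℝ h z 1)) z := by
      rw [hasDerivAt_iff_isLittleO]
      refine (hasFDerivAt_iff_isLittleO.1 hd.hasFDerivAt).congr_left fun w => ?_
      rw [key, LeftSlice.smul_def]; rfl
    exact this.differentiableAt

theorem isRegularOn_iff {f : ℍ[ℝ] → ℍ[ℝ]} {Ω : Set ℍ[ℝ]} :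
    IsRegularOn f Ω ↔
      ∀ I : imagUnits, ∀ z : ℂ, slicePoint I z ∈ Ω → DifferentiableAt ℂ (restrict I f) z := by
  constructor
  · intro h I z hz
    exact (differentiableAt_leftSlice_iff I (fun w => f (slicePoint I w)) z).2 (h I I.2 z hz)
  · intro h I hI z hz
    exact (differentiableAt_leftSlice_iff ⟨I, hI⟩ (fun w => f (slicePoint I w)) z).1
      (h ⟨I, hI⟩ z hz)

/-! ### Extension from a slice and the representation formula -/

/-- The value at `x + y J` of the extension of a function on the slice `L_I`, where `a` and `b`
are its values at `x + y I` and `x - y I`. -/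
def extendValue (I J a b : ℍ[ℝ]) : ℍ[ℝ] :=
  (1 / 2 : ℝ) • ((1 - J * I) * a + (1 + J * I) * b)

theorem extendValue_self (I J a : ℍ[ℝ]) : extendValue I J a a = a := by
  rw [extendValue, ← add_mul]
  have : (1 - J * I + (1 + J * I) : ℍ[ℝ]) = (2 : ℝ) • (1 : ℍ[ℝ]) := by
    rw [two_smul]; abel
  rw [this, smul_mul_assoc, one_mul, smul_smul]; norm_num

theorem extendValue_neg (I J a b : ℍ[ℝ]) : extendValue I (-J) a b = extendValue I J b a := by
  simp only [extendValue, neg_mul, sub_neg_eq_add, ← sub_eq_add_neg]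
  rw [add_comm]

/-- `1 - J I` intertwines left multiplication by `I` with that by `J`, and `1 + J I` does so up to
sign. Hence `extendValue` is complex linear in `a` and conjugate linear in `b`, from `L_I` to `L_J`.
-/
theorem mul_one_sub_mul {I J : ℍ[ℝ]} (hI : I ∈ imagUnits) (hJ : J ∈ imagUnits) :
    J * (1 - J * I) = (1 - J * I) * I := by
  rw [mul_sub, sub_mul, ← mul_assoc, imagUnits_mul_self hJ, mul_assoc, imagUnits_mul_self hI]
  simp [add_comm]

theorem mul_one_add_mul {I J : ℍ[ℝ]} (hI : I ∈ imagUnits) (hJ : J ∈ imagUnits) :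
    J * (1 + J * I) = -((1 + J * I) * I) := by
  rw [mul_add, add_mul, ← mul_assoc, imagUnits_mul_self hJ, mul_assoc, imagUnits_mul_self hI]
  simp

theorem mul_extendValue {I J : ℍ[ℝ]} (hI : I ∈ imagUnits) (hJ : J ∈ imagUnits) (a b : ℍ[ℝ]) :
    J * extendValue I J a b = extendValue I J (I * a) (-(I * b)) := by
  rw [extendValue, extendValue, mul_smul_comm, mul_add, ← mul_assoc, ← mul_assoc,
    mul_one_sub_mul hI hJ, mul_one_add_mul hI hJ, mul_assoc, neg_mul, mul_assoc, mul_neg]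

theorem extendValue_add (I J a b a' b' : ℍ[ℝ]) :
    extendValue I J a b + extendValue I J a' b' = extendValue I J (a + a') (b + b') := by
  simp only [extendValue, mul_add, smul_add]
  abel

theorem slicePoint_mul_extendValue {I J : ℍ[ℝ]} (hI : I ∈ imagUnits) (hJ : J ∈ imagUnits)
    (z : ℂ) (a b : ℍ[ℝ]) :
    slicePoint J z * extendValue I J a b =
      extendValue I J (slicePoint I z * a) (slicePoint I (star z) * b) := by
  have hr (r : ℝ) (a b : ℍ[ℝ]) :
      (r : ℍ[ℝ]) * extendValue I J a b = extendValue I J (r * a) (r * b) := by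
    simp only [Quaternion.coe_mul_eq_smul, extendValue, mul_smul_comm, ← smul_add]
  rw [slicePoint, add_mul, mul_assoc, mul_extendValue hI hJ, hr, hr, extendValue_add]
  simp [slicePoint, add_mul, mul_assoc]

/-- Conjugate linearity in the second argument cancels the antiholomorphy of `w ↦ h (star w)`. -/
theorem differentiableAt_extendValue (I J : imagUnits) {h : ℂ → ℍ[ℝ]} {z : ℂ}
    (hz : DifferentiableAt ℂ (fun w => LeftSlice.mk I (h w)) z)
    (hz' : DifferentiableAt ℂ (fun w => LeftSlice.mk I (h w)) (star z)) :
    DifferentiableAt ℂ (fun w => LeftSlice.mk J (extendValue I J (h w) (h (star w)))) z := by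
  rw [differentiableAt_leftSlice_iff] at hz hz' ⊢
  obtain ⟨d, e⟩ := hz
  obtain ⟨d', e'⟩ := hz'
  have hc : HasFDerivAt (fun w : ℂ => h (star w))
      ((fderiv ℝ h (star z)).comp (Complex.conjCLE : ℂ →L[ℝ] ℂ)) z :=
    HasFDerivAt.comp z (g := h) (f := fun w : ℂ => star w) d'.hasFDerivAt
      (Complex.conjCLE : ℂ →L[ℝ] ℂ).hasFDerivAt
  have hF := ((d.hasFDerivAt.const_mul (1 - (J : ℍ[ℝ]) * I)).add
    (hc.const_mul (1 + (J : ℍ[ℝ]) * I))).const_smul (1 / 2 : ℝ)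
  have hF' : HasFDerivAt (fun w => extendValue I J (h w) (h (star w))) _ z := hF
  refine ⟨hF'.differentiableAt, ?_⟩
  rw [hF'.fderiv]
  have hx : (fderiv ℝ h (star z)).comp (Complex.conjCLE : ℂ →L[ℝ] ℂ) 1
      = fderiv ℝ h (star z) 1 := by simp
  have hy : (fderiv ℝ h (star z)).comp (Complex.conjCLE : ℂ →L[ℝ] ℂ) Complex.I
      = -fderiv ℝ h (star z) Complex.I := by simp
  rw [smul_eq_zero_iff_right (by norm_num)] at e e' ⊢
  change extendValue I J (fderiv ℝ h z 1)
      ((fderiv ℝ h (star z)).comp (Complex.conjCLE : ℂ →L[ℝ] ℂ) 1) +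
    J * extendValue I J (fderiv ℝ h z Complex.I)
      ((fderiv ℝ h (star z)).comp (Complex.conjCLE : ℂ →L[ℝ] ℂ) Complex.I) = 0
  rw [hx, hy, mul_extendValue I.2 J.2, extendValue_add, mul_neg, neg_neg, e, e', extendValue_self]

/-- Both sides are holomorphic on the connected slice `D` and agree at its real points, where `I`
and `J` play no role; the identity theorem concludes. -/
theorem IsRegularOn.slicePoint_eq {f : ℍ[ℝ] → ℍ[ℝ]} {Ω : Set ℍ[ℝ]} (hf : IsRegularOn f Ω)
    (hΩ : IsSymmetricSliceDomain Ω) (I J : imagUnits) {z : ℂ} (hz : slicePoint I z ∈ Ω) :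
    f (slicePoint J z) = extendValue I J (f (slicePoint I z)) (f (slicePoint I (star z))) := by
  rw [isRegularOn_iff] at hf
  set D : Set ℂ := slicePoint J ⁻¹' Ω with hD
  have hDo : IsOpen D := hΩ.isOpen.preimage (continuous_slicePoint J)
  have hDI {w : ℂ} (hw : w ∈ D) : slicePoint I w ∈ Ω := hΩ.symmetric.slicePoint_mem J.2 I.2 hw
  have h1 : AnalyticOnNhd ℂ (restrict J f) D :=
    DifferentiableOn.analyticOnNhd (fun w hw => (hf J w hw).differentiableWithinAt) hDo
  have h2 : AnalyticOnNhd ℂ (fun w => LeftSlice.mk J (extendValue I J (f (slicePoint I w))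
      (f (slicePoint I (star w))))) D := by
    refine DifferentiableOn.analyticOnNhd (fun w hw => ?_) hDo
    exact (differentiableAt_extendValue I J (h := fun w => f (slicePoint I w)) (hf I w (hDI hw))
      (hf I (star w) (hΩ.symmetric.star_mem I.2 (hDI hw)))).differentiableWithinAt
  obtain ⟨x, hx⟩ := hΩ.meets_real
  have hxD : (x : ℂ) ∈ D := by
    change slicePoint J (x : ℂ) ∈ Ω
    rwa [slicePoint_ofReal]
  refine h1.eqOn_of_preconnected_of_frequently_eq h2 (hΩ.isConnected_slice J J.2).isPreconnected
    hxD ?_ (hΩ.symmetric.slicePoint_mem I.2 J.2 hz)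
  have hreal : ∃ᶠ y : ℝ in nhdsWithin x {x}ᶜ, restrict J f (y : ℂ) =
      LeftSlice.mk J (extendValue I J (f (slicePoint I (y : ℂ)))
        (f (slicePoint I (star (y : ℂ))))) := by
    refine Filter.Eventually.frequently (Filter.Eventually.of_forall fun y => ?_)
    have : star (y : ℂ) = (y : ℂ) := Complex.conj_ofReal y
    rw [this, extendValue_self, slicePoint_ofReal, restrict, slicePoint_ofReal]
  have ht : Filter.Tendsto (fun y : ℝ => (y : ℂ)) (nhdsWithin x {x}ᶜ)
      (nhdsWithin (x : ℂ) {(x : ℂ)}ᶜ) := by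
    refine tendsto_nhdsWithin_of_tendsto_nhds_of_eventually_within _
      (Complex.continuous_ofReal.continuousAt.tendsto.mono_left nhdsWithin_le_nhds) ?_
    filter_upwards [self_mem_nhdsWithin] with y hy
    simpa using hy
  exact ht.frequently hreal

/-! ### Existence of remainders -/

/-- One of the imaginary units. -/
def stdUnit : ℍ[ℝ] := ⟨0, 1, 0, 0⟩

theorem stdUnit_mem : stdUnit ∈ imagUnits := by
  change stdUnit ^ 2 = -1
  have h0 : stdUnit.re = 0 := rfl
  have h1 : stdUnit.imI = 1 := rfl
  have h2 : stdUnit.imJ = 0 := rfl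
  have h3 : stdUnit.imK = 0 := rfl
  rw [sq]; ext <;> simp [h0, h1, h2, h3]

theorem im_mul_self (q : ℍ[ℝ]) : q.im * q.im = -((‖q.im‖ * ‖q.im‖ : ℝ) : ℍ[ℝ]) := by
  have := Quaternion.self_mul_star q.im
  rw [Quaternion.normSq_eq_norm_mul_self, Quaternion.star_im, mul_neg] at this
  rw [← this, neg_neg]

theorem imagUnit_mem {q : ℍ[ℝ]} (h : q.im ≠ 0) : imagUnit q ∈ imagUnits := by
  have hn : ‖q.im‖ ≠ 0 := norm_ne_zero_iff.2 h
  change imagUnit q ^ 2 = -1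
  have h1 : ‖q.im‖⁻¹ * ‖q.im‖⁻¹ * (‖q.im‖ * ‖q.im‖) = 1 := by field_simp
  rw [sq, imagUnit, smul_mul_smul_comm, im_mul_self, smul_neg, ← Quaternion.coe_mul_eq_smul,
    ← Quaternion.coe_mul, h1, Quaternion.coe_one]

theorem slicePoint_imagUnit (q : ℍ[ℝ]) :
    slicePoint (imagUnit q) (⟨q.re, ‖q.im‖⟩ : ℂ) = q := by
  rw [slicePoint, imagUnit, Quaternion.coe_mul_eq_smul, smul_smul]
  by_cases h : q.im = 0
  · have := Quaternion.re_add_im q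
    rw [h] at this
    simpa [h] using this
  · rw [mul_inv_cancel₀ (norm_ne_zero_iff.2 h), one_smul]
    exact Quaternion.re_add_im q

theorem exists_slicePoint_eq (q : ℍ[ℝ]) :
    ∃ I : imagUnits, slicePoint I (⟨q.re, ‖q.im‖⟩ : ℂ) = q := by
  by_cases h : q.im = 0
  · refine ⟨⟨stdUnit, stdUnit_mem⟩, ?_⟩
    have := slicePoint_imagUnit q
    simpa [slicePoint, h] using this
  · exact ⟨⟨_, imagUnit_mem h⟩, slicePoint_imagUnit q⟩

theorem re_slicePoint {J : ℍ[ℝ]} (hJ : J ∈ imagUnits) (z : ℂ) : (slicePoint J z).re = z.re := by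
  simp [slicePoint, imagUnits_re hJ]

theorem im_slicePoint {J : ℍ[ℝ]} (hJ : J ∈ imagUnits) (z : ℂ) :
    (slicePoint J z).im = z.im • J := by
  ext <;> simp [slicePoint, imagUnits_re hJ]

theorem norm_im_slicePoint {J : ℍ[ℝ]} (hJ : J ∈ imagUnits) (z : ℂ) :
    ‖(slicePoint J z).im‖ = |z.im| := by
  rw [im_slicePoint hJ, norm_smul, norm_imagUnits hJ, mul_one, Real.norm_eq_abs]

theorem imagUnit_slicePoint {J : ℍ[ℝ]} (hJ : J ∈ imagUnits) (z : ℂ) :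
    imagUnit (slicePoint J z) = (|z.im|⁻¹ * z.im) • J := by
  rw [imagUnit, norm_im_slicePoint hJ, im_slicePoint hJ, smul_smul]

theorem imagUnit_slicePoint_cases {J : ℍ[ℝ]} (hJ : J ∈ imagUnits) (z : ℂ) :
    (imagUnit (slicePoint J z) = J ∧ |z.im| = z.im) ∨
      (imagUnit (slicePoint J z) = -J ∧ |z.im| = -z.im) ∨
      (imagUnit (slicePoint J z) = 0 ∧ z.im = 0) := by
  rw [imagUnit_slicePoint hJ]
  rcases lt_trichotomy z.im 0 with h | h | h
  · refine Or.inr (Or.inl ⟨?_, abs_of_neg h⟩)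
    rw [abs_of_neg h, inv_neg, neg_mul, inv_mul_cancel₀ h.ne]; simp
  · exact Or.inr (Or.inr ⟨by simp [h], h⟩)
  · refine Or.inl ⟨?_, abs_of_pos h⟩
    rw [abs_of_pos h, inv_mul_cancel₀ h.ne', one_smul]

/-- The extension to `ℍ` of a function on the slice `L_I`. -/
def extend (I : ℍ[ℝ]) (h : ℂ → ℍ[ℝ]) (q : ℍ[ℝ]) : ℍ[ℝ] :=
  extendValue I (imagUnit q) (h ⟨q.re, ‖q.im‖⟩) (h (star ⟨q.re, ‖q.im‖⟩))

/-- The definition uses the representation with `y ≥ 0`. Replacing `(J, z)` by `(-J, star z)`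
changes nothing, and at real points the unit is immaterial. -/
theorem extend_slicePoint (I : ℍ[ℝ]) {J : ℍ[ℝ]} (hJ : J ∈ imagUnits) (h : ℂ → ℍ[ℝ]) (z : ℂ) :
    extend I h (slicePoint J z) = extendValue I J (h z) (h (star z)) := by
  rw [extend, re_slicePoint hJ, norm_im_slicePoint hJ]
  rcases imagUnit_slicePoint_cases hJ z with ⟨hu, hy⟩ | ⟨hu, hy⟩ | ⟨hu, hy⟩
  · rw [hu, hy]
  · have h1 : (⟨z.re, -z.im⟩ : ℂ) = star z := rfl
    rw [hu, hy, extendValue_neg, h1, star_star]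
  · have h1 : (⟨z.re, |z.im|⟩ : ℂ) = z := by apply Complex.ext <;> simp [hy]
    have h2 : star z = z := by apply Complex.ext <;> simp [hy]
    rw [h1, h2, extendValue_self, extendValue_self]

theorem isRegularOn_extend {Ω : Set ℍ[ℝ]} (hΩ : IsAxiallySymmetric Ω) (I : imagUnits)
    {h : ℂ → ℍ[ℝ]}
    (hh : ∀ z, slicePoint I z ∈ Ω → DifferentiableAt ℂ (fun w => LeftSlice.mk I (h w)) z) :
    IsRegularOn (extend I h) Ω := by
  rw [isRegularOn_iff]
  intro J z hz
  have hz' : slicePoint I z ∈ Ω := hΩ.slicePoint_mem J.2 I.2 hz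
  have := differentiableAt_extendValue I J (hh z hz') (hh (star z) (hΩ.star_mem I.2 hz'))
  convert this using 2 with w
  rw [restrict, extend_slicePoint _ J.2]

/-- The constant `p` has components `p` and `0`, so its regular product with `g` is `p γ + J p δ`;
here `γ` and `δ` are expressed by the values of `g` at the two conjugate points. -/
theorem regularMul_sub_slicePoint {J : ℍ[ℝ]} (hJ : J ∈ imagUnits) (p : ℍ[ℝ]) (g : ℍ[ℝ] → ℍ[ℝ])
    (z : ℂ) :
    regularMul (fun s => s - p) g (slicePoint J z) = slicePoint J z * g (slicePoint J z) -
      (1 / 2 : ℝ) • ((p - J * p * J) * g (slicePoint J z) +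
        (p + J * p * J) * g (slicePoint J (star z))) := by
  set q := slicePoint J z with hq
  have hs : star q = slicePoint J (star z) := star_slicePoint hJ z
  rw [← hs, regularMul]
  -- `u` will be `J` or `-J`, according to the sign of `z.im`.
  have key (u : ℍ[ℝ]) (y : ℝ) (hu : u * u = -1) (hqy : q = (z.re : ℍ[ℝ]) + y • u)
      (hqs : star q = (z.re : ℍ[ℝ]) - y • u) (huq : imagUnit q = u) :
      (stemRe (fun s => s - p) q * stemRe g q - stemIm (fun s => s - p) q * stemIm g q)
        + imagUnit q * (stemRe (fun s => s - p) q * stemIm g q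
          + stemIm (fun s => s - p) q * stemRe g q) = q * g q -
      (1 / 2 : ℝ) • ((p - u * p * u) * g q + (p + u * p * u) * g (star q)) := by
    have e1 : stemRe (fun s => s - p) q = (z.re : ℍ[ℝ]) - p := by
      rw [stemRe, hqs, hqy]; module
    have e2 : stemIm (fun s => s - p) q = (y : ℍ[ℝ]) := by
      rw [stemIm, huq, hqs]
      conv_lhs => rw [hqy]
      have : ((z.re : ℍ[ℝ]) + y • u - p - (z.re - y • u - p)) = (2 * y) • u := by module
      rw [this, mul_smul_comm, hu, ← mul_one (y : ℍ[ℝ]), Quaternion.coe_mul_eq_smul]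
      module
    have e3 : stemRe g q + u * stemIm g q = g q := by
      rw [stemRe, stemIm, huq, mul_neg, mul_smul_comm, ← mul_assoc, hu]
      rw [neg_one_mul]; module
    have e4 : stemIm g q = -((1 / 2 : ℝ) • (u * (g q - g (star q)))) := by rw [stemIm, huq]
    have e5 : stemRe g q = (1 / 2 : ℝ) • (g q + g (star q)) := rfl
    have e6 : q * g q = q * stemRe g q + q * (u * stemIm g q) := by rw [← mul_add, e3]
    rw [e1, e2, huq, e6, e4, e5, hqy]
    simp only [Quaternion.coe_mul_eq_smul, add_mul, sub_mul, mul_add, mul_sub, smul_mul_assoc,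
      mul_smul_comm, mul_neg, neg_mul, ← mul_assoc, hu, one_mul, smul_neg, smul_add,
      smul_sub]
    simp only [mul_assoc]
    module
  have hJ2 := imagUnits_mul_self hJ
  have hq' : q = (z.re : ℍ[ℝ]) + z.im • J := by
    rw [hq, slicePoint, Quaternion.coe_mul_eq_smul]
  have hs' : star q = (z.re : ℍ[ℝ]) - z.im • J := by
    rw [hs, slicePoint, Quaternion.coe_mul_eq_smul]; simp [sub_eq_add_neg]
  rcases imagUnit_slicePoint_cases hJ z with ⟨hu, -⟩ | ⟨hu, -⟩ | ⟨hu, hy⟩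
  · exact key J z.im hJ2 hq' hs' hu
  · have := key (-J) (-z.im) (by rw [neg_mul_neg, hJ2]) (by rw [neg_smul_neg]; exact hq')
      (by rw [neg_smul_neg]; exact hs') hu
    rw [this]
    simp
  · have hst : star q = q := by rw [hs', hq', hy]; simp
    have huq : imagUnit q = 0 := hu
    have e1 : stemRe (fun s => s - p) q = q - p := by rw [stemRe, hst]; module
    have e2 : stemRe g q = g q := by rw [stemRe, hst]; module
    have e3 : stemIm g q = 0 := by rw [stemIm, hst]; simp
    rw [e1, e2, e3, huq, hst, sub_mul, ← add_mul]
    have e4 : (p - J * p * J + (p + J * p * J)) = (2 : ℝ) • p := by rw [two_smul]; abel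
    rw [e4, smul_mul_assoc, smul_smul]
    simp

theorem slicePoint_commute (I : ℍ[ℝ]) (z : ℂ) : slicePoint I z * I = I * slicePoint I z := by
  rw [slicePoint, add_mul, mul_add, Quaternion.coe_mul_eq_smul, Quaternion.coe_mul_eq_smul,
    Quaternion.mul_coe_eq_smul, mul_smul_comm, smul_mul_assoc]

/-- On a slice through `p`, the regular product with `s ↦ s - p` is the pointwise product. -/
theorem regularMul_sub_slicePoint_same {I : ℍ[ℝ]} (hI : I ∈ imagUnits) (z₀ z : ℂ)
    (g : ℍ[ℝ] → ℍ[ℝ]) :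
    regularMul (fun s => s - slicePoint I z₀) g (slicePoint I z) =
      (slicePoint I z - slicePoint I z₀) * g (slicePoint I z) := by
  rw [regularMul_sub_slicePoint hI, ← slicePoint_commute, mul_assoc, imagUnits_mul_self hI]
  simp only [mul_neg, mul_one, sub_neg_eq_add, add_neg_cancel, zero_mul, add_zero]
  rw [sub_mul, ← two_smul ℝ (slicePoint I z₀), smul_mul_assoc, smul_smul]
  norm_num

/-- Extension from `L_I` carries pointwise left multiplication by `p ∈ L_I` to the regular product
with the constant `p`; `extendValue I J b a` is the value at the conjugate point. -/
theorem extendValue_mul_commute {I J p : ℍ[ℝ]} (hI : I ∈ imagUnits) (hJ : J ∈ imagUnits)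
    (hp : p * I = I * p) (a b : ℍ[ℝ]) :
    extendValue I J (p * a) (p * b) = (1 / 2 : ℝ) • ((p - J * p * J) * extendValue I J a b +
      (p + J * p * J) * extendValue I J b a) := by
  have hI2 := imagUnits_mul_self hI
  have hJ2 (x : ℍ[ℝ]) : J * (J * x) = -x := by
    rw [← mul_assoc, imagUnits_mul_self hJ, neg_one_mul]
  have hp' (x : ℍ[ℝ]) : p * (I * x) = I * (p * x) := by
    rw [← mul_assoc, hp, mul_assoc]
  simp only [extendValue, mul_smul_comm, add_mul, sub_mul, mul_add, mul_sub, one_mul, mul_assoc,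
    hJ2, hp', mul_neg]
  module

/-- The difference quotient on the slice through `p` has a removable singularity there. Its
extension is regular, and the factorization on `L_I` extends with it. -/
theorem exists_isRemainder {Ω : Set ℍ[ℝ]} (hΩ : IsSymmetricSliceDomain Ω) {f : ℍ[ℝ] → ℍ[ℝ]}
    (hf : IsRegularOn f Ω) (I : imagUnits) {z₀ : ℂ} (hz₀ : slicePoint I z₀ ∈ Ω) :
    ∃ g, IsRemainder Ω (slicePoint I z₀) f g := by
  set p := slicePoint I z₀ with hp
  set h : ℂ → ℍ[ℝ] := fun z => (dslope (restrict I f) z₀ z).val with hh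
  have hDo : IsOpen (slicePoint I ⁻¹' Ω) := hΩ.isOpen.preimage (continuous_slicePoint I)
  have hd : DifferentiableOn ℂ (dslope (restrict I f) z₀) (slicePoint I ⁻¹' Ω) := by
    rw [Complex.differentiableOn_dslope (hDo.mem_nhds hz₀)]
    exact fun z hz => (isRegularOn_iff.1 hf I z hz).differentiableWithinAt
  have hfh (z : ℂ) : f (slicePoint I z) = f p + (slicePoint I z - p) * h z := by
    have e : (z - z₀) • dslope (restrict I f) z₀ z = restrict I f z - restrict I f z₀ :=
      sub_smul_dslope (restrict I f) z₀ z
    have e2 : (slicePoint I (z - z₀)) * h z = f (slicePoint I z) - f p := by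
      have := LeftSlice.smul_def (I := I) (z - z₀) (h z)
      exact this.symm.trans e
    rw [← sliceHom_apply, map_sub, sliceHom_apply, sliceHom_apply] at e2
    rw [e2]; abel
  refine ⟨extend I h, isRegularOn_extend hΩ.symmetric I fun z hz =>
    (hd z hz).differentiableAt (hDo.mem_nhds hz), fun q hq => ?_⟩
  obtain ⟨J, hJ⟩ := exists_slicePoint_eq q
  set w : ℂ := ⟨q.re, ‖q.im‖⟩
  rw [← hJ] at hq ⊢
  have hw : slicePoint I w ∈ Ω := hΩ.symmetric.slicePoint_mem J.2 I.2 hq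
  rw [hf.slicePoint_eq hΩ I J hw, regularMul_sub_slicePoint J.2, extend_slicePoint _ J.2,
    extend_slicePoint _ J.2, star_star, ← extendValue_mul_commute I.2 J.2
      (slicePoint_commute I z₀), slicePoint_mul_extendValue I.2 J.2, hfh w, hfh (star w)]
  have e1 : f p = extendValue I J (f p) (f p) := (extendValue_self _ _ _).symm
  conv_rhs => rw [e1]
  simp only [extendValue, ← smul_sub, ← smul_add]
  congr 1
  noncomm_ring

theorem IsRemainder.restrict_eq {Ω : Set ℍ[ℝ]} {f g : ℍ[ℝ] → ℍ[ℝ]} {I : imagUnits} {z₀ z : ℂ}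
    (h : IsRemainder Ω (slicePoint I z₀) f g) (hz : slicePoint I z ∈ Ω) :
    restrict I f z = restrict I f z₀ + (z - z₀) • restrict I g z := by
  have e := h.2 _ hz
  rw [regularMul_sub_slicePoint_same I.2] at e
  rw [restrict, restrict, restrict, LeftSlice.smul_def, ← sliceHom_apply,
    ← sliceHom_apply I (z - z₀), map_sub,
    sliceHom_apply, sliceHom_apply]
  exact e

/-- Only the defining property of the chosen function is ever used, so uniqueness is not needed. -/
theorem isRemainder_remainder {Ω : Set ℍ[ℝ]} (hΩ : IsSymmetricSliceDomain Ω) {f : ℍ[ℝ] → ℍ[ℝ]}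
    (hf : IsRegularOn f Ω) (I : imagUnits) {z₀ : ℂ} (hz₀ : slicePoint I z₀ ∈ Ω) :
    IsRemainder Ω (slicePoint I z₀) f (remainder Ω (slicePoint I z₀) f) := by
  have h := exists_isRemainder hΩ hf I hz₀
  rw [remainder, dif_pos h]
  exact Classical.choose_spec h

theorem remainderIter_succ (Ω : Set ℍ[ℝ]) (p : ℍ[ℝ]) (f : ℍ[ℝ] → ℍ[ℝ]) (n : ℕ) :
    remainderIter Ω p f (n + 1) =
      remainder Ω (star p) (remainder Ω p (remainderIter Ω p f n)) :=
  Function.iterate_succ_apply' _ _ _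

theorem isRegularOn_remainderIter {Ω : Set ℍ[ℝ]} (hΩ : IsSymmetricSliceDomain Ω)
    {f : ℍ[ℝ] → ℍ[ℝ]} (hf : IsRegularOn f Ω) (I : imagUnits) {z₀ : ℂ}
    (hz₀ : slicePoint I z₀ ∈ Ω) (n : ℕ) :
    IsRegularOn (remainderIter Ω (slicePoint I z₀) f n) Ω := by
  induction n with
  | zero => exact hf
  | succ n ih =>
    rw [remainderIter_succ, star_slicePoint I.2]
    exact (isRemainder_remainder hΩ (isRemainder_remainder hΩ ih I hz₀).1 I
      (hΩ.symmetric.star_mem I.2 hz₀)).1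

/-! ### Coefficient estimates -/

section CoefficientEstimates

open Complex Set MeasureTheory intervalIntegral

variable {E : Type*} [NormedAddCommGroup E] [NormedSpace ℂ E]

theorem sq_cpow_half (w : ℂ) : (w ^ (2⁻¹ : ℂ)) ^ 2 = w := by
  simp

/-- An even function which is holomorphic in the variable `s` is a holomorphic function of `s²`. -/
theorem differentiableAt_comp_cpow_half [CompleteSpace E] {e : ℂ → E} {V : Set ℂ} (hV : IsOpen V)
    (hneg : ∀ s ∈ V, -s ∈ V) (hd : DifferentiableOn ℂ e V) (heven : ∀ s, e (-s) = e s)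
    {w : ℂ} (hw : w ^ (2⁻¹ : ℂ) ∈ V) : DifferentiableAt ℂ (fun v => e (v ^ (2⁻¹ : ℂ))) w := by
  have hd' {s : ℂ} (hs : s ∈ V) : DifferentiableAt ℂ e s := hd.differentiableAt (hV.mem_nhds hs)
  have hne {u : ℂ} (hu0 : u ≠ 0) (hu : u ^ (2⁻¹ : ℂ) ∈ V) :
      DifferentiableAt ℂ (fun v => e (v ^ (2⁻¹ : ℂ))) u := by
    by_cases hs : u ∈ slitPlane
    · exact DifferentiableAt.comp u (hd' hu) (differentiableAt_id.cpow_const hs)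
    · have hs' : -u ∈ slitPlane := by
        rw [mem_slitPlane_iff] at hs ⊢
        push Not at hs
        refine Or.inl (lt_of_le_of_ne (by simpa using hs.1) fun h => hu0 ?_)
        apply Complex.ext
        · simpa using h.symm
        · exact hs.2
      -- On the cut, `I * (-v) ^ (1/2)` is a root holomorphic near `u`; evenness of `e` hides the
      -- sign by which it differs from the principal root.
      have hroot (v : ℂ) : v ^ (2⁻¹ : ℂ) = I * (-v) ^ (2⁻¹ : ℂ) ∨
          v ^ (2⁻¹ : ℂ) = -(I * (-v) ^ (2⁻¹ : ℂ)) := by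
        rw [← sq_eq_sq_iff_eq_or_eq_neg, mul_pow, sq_cpow_half, sq_cpow_half, I_sq]
        ring
      have heq : (fun v => e (v ^ (2⁻¹ : ℂ))) = fun v => e (I * (-v) ^ (2⁻¹ : ℂ)) := by
        funext v
        rcases hroot v with h | h
        · rw [h]
        · rw [h, heven]
      have hmem : I * (-u) ^ (2⁻¹ : ℂ) ∈ V := by
        rcases hroot u with h | h
        · rwa [← h]
        · have := hneg _ hu
          rwa [h, neg_neg] at this
      rw [heq]
      refine DifferentiableAt.comp u (g := e) (f := fun v : ℂ => I * (-v) ^ (2⁻¹ : ℂ)) (hd' hmem) ?_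
      exact (differentiableAt_id.neg.cpow_const hs').const_mul I
  by_cases h0 : w = 0
  · subst h0
    -- At the branch point the root is only continuous, which suffices for a removable singularity.
    have hc : ContinuousAt (fun v : ℂ => v ^ (2⁻¹ : ℂ)) 0 := by
      apply continuousAt_cpow_const_of_re_pos <;> simp
    refine (analyticAt_of_differentiable_on_punctured_nhds_of_continuousAt ?_ ?_).differentiableAt
    · have := hc.eventually_mem (hV.mem_nhds hw)
      filter_upwards [nhdsWithin_le_nhds this, self_mem_nhdsWithin] with v hv hv0
      exact hne hv0 hv
    · exact ContinuousAt.comp (f := fun v : ℂ => v ^ (2⁻¹ : ℂ)) (hd' hw).continuousAt hc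
  · exact hne h0 hw

/-- Each use of the recurrence lowers the power of `w` by one, since `∮ w⁻ʲ = 0` for `j ≥ 2`;
Cauchy's formula for `a n 0 = κ n` ends the induction. -/
theorem circleIntegral_eq_coeff [CompleteSpace E] {ρ : ℝ} (hρ : 0 < ρ) {a : ℕ → ℂ → E} {κ : ℕ → E}
    (hd : ∀ n, ∀ w ∈ Metric.closedBall (0 : ℂ) ρ, DifferentiableAt ℂ (a n) w)
    (hrec : ∀ n, ∀ w ∈ Metric.closedBall (0 : ℂ) ρ, a n w = κ n + w • a (n + 1) w) (m n : ℕ) :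
    (∮ w in C(0, ρ), (w ^ (m + 1))⁻¹ • a n w) = (2 * Real.pi * I : ℂ) • κ (n + m) := by
  induction m generalizing n with
  | zero =>
    have hc : DiffContOnCl ℂ (a n) (Metric.ball 0 ρ) := by
      refine DifferentiableOn.diffContOnCl fun w hw => ?_
      exact (hd n w (Metric.closure_ball_subset_closedBall hw)).differentiableWithinAt
    have h := hc.circleIntegral_sub_inv_smul (Metric.mem_ball_self hρ)
    have h0 : a n 0 = κ n := by
      rw [hrec n 0 (Metric.mem_closedBall_self hρ.le)]; simp
    simpa [h0] using h
  | succ m ih =>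
    have hcont (j : ℕ) : ContinuousOn (fun w : ℂ => (w ^ (j + 1))⁻¹) (Metric.sphere 0 ρ) := by
      refine ContinuousOn.inv₀ (by fun_prop) fun w hw => pow_ne_zero _ ?_
      exact Metric.ne_of_mem_sphere hw hρ.ne'
    have hint1 : CircleIntegrable (fun w : ℂ => (w ^ (m + 1 + 1))⁻¹ • κ n) 0 ρ :=
      ContinuousOn.circleIntegrable hρ.le ((hcont _).smul continuousOn_const)
    have hint2 : CircleIntegrable (fun w : ℂ => (w ^ (m + 1))⁻¹ • a (n + 1) w) 0 ρ := by
      refine ContinuousOn.circleIntegrable hρ.le ((hcont _).smul fun w hw => ?_)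
      exact (hd (n + 1) w (Metric.sphere_subset_closedBall hw)).continuousAt.continuousWithinAt
    have e : (∮ w in C(0, ρ), (w ^ (m + 1 + 1))⁻¹ • a n w) = ∮ w in C(0, ρ),
        ((w ^ (m + 1 + 1))⁻¹ • κ n + (w ^ (m + 1))⁻¹ • a (n + 1) w) := by
      refine circleIntegral.integral_congr hρ.le fun w hw => ?_
      have hw0 : w ≠ 0 := Metric.ne_of_mem_sphere hw hρ.ne'
      rw [hrec n w (Metric.sphere_subset_closedBall hw), smul_add, smul_smul]
      congr 2
      rw [pow_succ w (m + 1)]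
      field_simp
    have hz : (∮ w in C(0, ρ), (w ^ (m + 1 + 1))⁻¹) = 0 := by
      have := circleIntegral.integral_sub_zpow_of_ne (n := -((m + 1 + 1 : ℕ) : ℤ)) (by omega) 0 0 ρ
      simpa only [zpow_neg, zpow_natCast, sub_zero] using this
    rw [e, circleIntegral.integral_add hint1 hint2, circleIntegral.integral_smul_const, hz,
      zero_smul, zero_add, ih (n + 1)]
    congr 2
    omega

/-- A bound by an integrable `B` almost everywhere, instead of a constant, admits the singularity of
the odd part. -/
theorem norm_coeff_le [CompleteSpace E] {ρ : ℝ} (hρ : 0 < ρ) {a : ℕ → ℂ → E} {κ : ℕ → E}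
    (hd : ∀ n, ∀ w ∈ Metric.closedBall (0 : ℂ) ρ, DifferentiableAt ℂ (a n) w)
    (hrec : ∀ n, ∀ w ∈ Metric.closedBall (0 : ℂ) ρ, a n w = κ n + w • a (n + 1) w)
    {B : ℝ → ℝ} (hB : IntervalIntegrable B volume 0 (2 * Real.pi))
    (hbound : ∀ᵐ θ : ℝ, ‖a 0 (circleMap 0 ρ θ)‖ ≤ B θ) (m : ℕ) :
    ‖κ m‖ ≤ (2 * Real.pi)⁻¹ * (∫ θ in 0..2 * Real.pi, B θ) / ρ ^ m := by
  have h := circleIntegral_eq_coeff hρ hd hrec m 0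
  rw [zero_add] at h
  have hle : ‖∮ w in C(0, ρ), (w ^ (m + 1))⁻¹ • a 0 w‖ ≤
      ∫ θ in 0..2 * Real.pi, (ρ ^ m)⁻¹ * B θ := by
    rw [circleIntegral]
    refine norm_integral_le_of_norm_le Real.two_pi_pos.le ?_ (hB.const_mul _)
    filter_upwards [hbound] with θ hθ _
    rw [deriv_circleMap, norm_smul, norm_smul, norm_mul, norm_inv, norm_pow, norm_circleMap_zero,
      norm_I, abs_of_pos hρ, mul_one, ← mul_assoc]
    have e : ρ * (ρ ^ (m + 1))⁻¹ = (ρ ^ m)⁻¹ := by rw [pow_succ]; field_simp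
    rw [e]
    gcongr
  rw [h, intervalIntegral.integral_const_mul, norm_smul] at hle
  have hn : ‖(2 * Real.pi * I : ℂ)‖ = 2 * Real.pi := by
    simp [abs_of_pos Real.pi_pos]
  rw [hn] at hle
  have hp := Real.two_pi_pos
  rw [div_eq_inv_mul, mul_left_comm, ← div_eq_inv_mul, le_div_iff₀' hp]
  exact hle

/-- Jordan's inequality `sin θ ≥ 2θ/π` reduces the first quarter period to `θ^(-1/2)`; symmetry
gives the rest. -/
theorem intervalIntegrable_inv_sqrt_abs_sin :
    IntervalIntegrable (fun θ : ℝ => (√|Real.sin θ|)⁻¹) volume 0 (2 * Real.pi) := by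
  have hm : Measurable fun θ : ℝ => (√|Real.sin θ|)⁻¹ := by fun_prop
  have h1 : IntervalIntegrable (fun θ : ℝ => (√|Real.sin θ|)⁻¹) volume 0 (Real.pi / 2) := by
    have hg : IntervalIntegrable (fun θ : ℝ => (√(2 / Real.pi))⁻¹ * θ ^ (-(1 / 2) : ℝ)) volume 0
        (Real.pi / 2) := (intervalIntegrable_rpow' (by norm_num)).const_mul _
    refine hg.mono_fun' hm.aestronglyMeasurable ?_
    filter_upwards [ae_restrict_mem measurableSet_uIoc] with θ hθ
    rw [uIoc_of_le (by positivity)] at hθ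
    have hs := Real.mul_le_sin hθ.1.le hθ.2
    have hp := Real.pi_pos
    have hpos : 0 < 2 / Real.pi * θ := mul_pos (by positivity) hθ.1
    rw [Real.norm_of_nonneg (by positivity), Real.rpow_neg hθ.1.le, ← Real.sqrt_eq_rpow,
      ← mul_inv, ← Real.sqrt_mul (by positivity), abs_of_pos (hpos.trans_le hs)]
    have := Real.sqrt_pos.2 hpos
    gcongr
  have h2 : IntervalIntegrable (fun θ : ℝ => (√|Real.sin θ|)⁻¹) volume (Real.pi / 2) Real.pi := by
    have := (h1.comp_sub_left Real.pi).symm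
    simp only [Real.sin_pi_sub] at this
    convert this using 1 <;> ring
  have h3 := h1.trans h2
  have h4 : IntervalIntegrable (fun θ : ℝ => (√|Real.sin θ|)⁻¹) volume Real.pi (2 * Real.pi) := by
    have := h3.comp_sub_right Real.pi
    simp only [Real.sin_sub_pi, abs_neg] at this
    convert this using 1 <;> ring
  exact h3.trans h4

theorem ae_sin_ne_zero : ∀ᵐ θ : ℝ, Real.sin θ ≠ 0 := by
  have : {θ : ℝ | Real.sin θ = 0}.Countable := by
    refine (countable_range fun n : ℤ => (n : ℝ) * Real.pi).mono fun θ hθ => ?_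
    exact Real.sin_eq_zero_iff.1 hθ
  exact measure_mono_null (fun θ hθ => by simpa using hθ) (this.measure_zero volume)

/-- The even part of `s ↦ φ (x₀ + s)`. -/
def evenPart (x₀ : ℂ) (φ : ℂ → E) (s : ℂ) : E := (1 / 2 : ℂ) • (φ (x₀ + s) + φ (x₀ - s))

/-- The odd part of `s ↦ φ (x₀ + s)`. -/
def oddPart (x₀ : ℂ) (φ : ℂ → E) (s : ℂ) : E := (1 / 2 : ℂ) • (φ (x₀ + s) - φ (x₀ - s))

theorem evenPart_neg (x₀ : ℂ) (φ : ℂ → E) (s : ℂ) : evenPart x₀ φ (-s) = evenPart x₀ φ s := by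
  rw [evenPart, evenPart, sub_neg_eq_add, ← sub_eq_add_neg, add_comm]

theorem oddPart_neg (x₀ : ℂ) (φ : ℂ → E) (s : ℂ) : oddPart x₀ φ (-s) = -oddPart x₀ φ s := by
  rw [oddPart, oddPart, sub_neg_eq_add, ← sub_eq_add_neg, ← smul_neg, neg_sub]

theorem oddPart_zero (x₀ : ℂ) (φ : ℂ → E) : oddPart x₀ φ 0 = 0 := by
  simp [oddPart]

theorem smul_dslope_oddPart (x₀ : ℂ) (φ : ℂ → E) (s : ℂ) :
    s • dslope (oddPart x₀ φ) 0 s = oddPart x₀ φ s := by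
  have := sub_smul_dslope (oddPart x₀ φ) 0 s
  rwa [sub_zero, oddPart_zero, sub_zero] at this

theorem dslope_oddPart_neg (x₀ : ℂ) (φ : ℂ → E) (s : ℂ) :
    dslope (oddPart x₀ φ) 0 (-s) = dslope (oddPart x₀ φ) 0 s := by
  by_cases hs : s = 0
  · simp [hs]
  · refine smul_right_injective E hs ?_
    simp only
    rw [smul_dslope_oddPart, ← neg_neg (s • _), ← neg_smul, smul_dslope_oddPart, oddPart_neg,
      neg_neg]

section Estimate

variable {D : Set ℂ} {x₀ : ℂ} {φ : ℂ → E}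

theorem isOpen_add_sub_mem (hD : IsOpen D) : IsOpen {s | x₀ + s ∈ D ∧ x₀ - s ∈ D} :=
  (hD.preimage (f := fun s : ℂ => x₀ + s) (by fun_prop)).inter
    (hD.preimage (f := fun s : ℂ => x₀ - s) (by fun_prop))

theorem differentiableOn_add_sub (hφ : DifferentiableOn ℂ φ D) :
    DifferentiableOn ℂ (fun s => φ (x₀ + s)) {s | x₀ + s ∈ D ∧ x₀ - s ∈ D} ∧
      DifferentiableOn ℂ (fun s => φ (x₀ - s)) {s | x₀ + s ∈ D ∧ x₀ - s ∈ D} :=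
  ⟨hφ.comp (by fun_prop) fun _ hs => hs.1, hφ.comp (by fun_prop) fun _ hs => hs.2⟩

theorem differentiableOn_evenPart (hφ : DifferentiableOn ℂ φ D) :
    DifferentiableOn ℂ (evenPart x₀ φ) {s | x₀ + s ∈ D ∧ x₀ - s ∈ D} :=
  ((differentiableOn_add_sub hφ).1.add (differentiableOn_add_sub hφ).2).const_smul _

theorem differentiableOn_oddPart (hφ : DifferentiableOn ℂ φ D) :
    DifferentiableOn ℂ (oddPart x₀ φ) {s | x₀ + s ∈ D ∧ x₀ - s ∈ D} :=
  ((differentiableOn_add_sub hφ).1.sub (differentiableOn_add_sub hφ).2).const_smul _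

theorem differentiableOn_dslope_oddPart [CompleteSpace E] (hD : IsOpen D)
    (hφ : DifferentiableOn ℂ φ D) :
    DifferentiableOn ℂ (dslope (oddPart x₀ φ) 0) {s | x₀ + s ∈ D ∧ x₀ - s ∈ D} := by
  by_cases h0 : (0 : ℂ) ∈ {s | x₀ + s ∈ D ∧ x₀ - s ∈ D}
  · exact (Complex.differentiableOn_dslope ((isOpen_add_sub_mem hD).mem_nhds h0)).2
      (differentiableOn_oddPart hφ)
  · exact (_root_.differentiableOn_dslope_of_notMem h0).2 (differentiableOn_oddPart hφ)

theorem norm_evenPart_le {s : ℂ} {M : ℝ} (h1 : ‖φ (x₀ + s)‖ ≤ M) (h2 : ‖φ (x₀ - s)‖ ≤ M) :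
    ‖evenPart x₀ φ s‖ ≤ M := by
  rw [evenPart, norm_smul]
  have := norm_add_le (φ (x₀ + s)) (φ (x₀ - s))
  norm_num
  linarith

theorem norm_oddPart_le {s : ℂ} {M : ℝ} (h1 : ‖φ (x₀ + s)‖ ≤ M) (h2 : ‖φ (x₀ - s)‖ ≤ M) :
    ‖oddPart x₀ φ s‖ ≤ M := by
  rw [oddPart, norm_smul]
  have := norm_sub_le (φ (x₀ + s)) (φ (x₀ - s))
  norm_num
  linarith

variable {c : ℂ} {φ ψ : ℂ → E} {κ μ : E}

theorem evenPart_eq_of_rec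
    (h : ∀ z ∈ D, φ z = κ + (z - x₀) • μ + ((z - x₀) ^ 2 + c) • ψ z) {s : ℂ}
    (hs : s ∈ {s | x₀ + s ∈ D ∧ x₀ - s ∈ D}) :
    evenPart x₀ φ s = κ + (s ^ 2 + c) • evenPart x₀ ψ s := by
  rw [evenPart, evenPart, h _ hs.1, h _ hs.2]
  have e1 : x₀ + s - x₀ = s := by ring
  have e2 : x₀ - s - x₀ = -s := by ring
  rw [e1, e2, neg_sq]
  module

theorem oddPart_eq_of_rec
    (h : ∀ z ∈ D, φ z = κ + (z - x₀) • μ + ((z - x₀) ^ 2 + c) • ψ z) {s : ℂ}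
    (hs : s ∈ {s | x₀ + s ∈ D ∧ x₀ - s ∈ D}) :
    oddPart x₀ φ s = s • μ + (s ^ 2 + c) • oddPart x₀ ψ s := by
  rw [oddPart, oddPart, h _ hs.1, h _ hs.2]
  have e1 : x₀ + s - x₀ = s := by ring
  have e2 : x₀ - s - x₀ = -s := by ring
  rw [e1, e2, neg_sq]
  module

/-- This is the odd recurrence divided by `s`. At `s = 0` it is differentiated instead, and `s² + c`
has derivative zero there. -/
theorem dslope_oddPart_eq_of_rec (hD : IsOpen D) (hψ : DifferentiableOn ℂ ψ D)
    (h : ∀ z ∈ D, φ z = κ + (z - x₀) • μ + ((z - x₀) ^ 2 + c) • ψ z) {s : ℂ}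
    (hs : s ∈ {s | x₀ + s ∈ D ∧ x₀ - s ∈ D}) :
    dslope (oddPart x₀ φ) 0 s = μ + (s ^ 2 + c) • dslope (oddPart x₀ ψ) 0 s := by
  have hV := isOpen_add_sub_mem (x₀ := x₀) hD
  by_cases h0 : s = 0
  · subst h0
    rw [dslope_same, dslope_same]
    have hd : HasDerivAt (oddPart x₀ ψ) (deriv (oddPart x₀ ψ) 0) 0 :=
      ((differentiableOn_oddPart hψ).differentiableAt (hV.mem_nhds hs)).hasDerivAt
    have h1 : HasDerivAt (fun s : ℂ => s ^ 2 + c) 0 0 := by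
      simpa using (hasDerivAt_pow 2 (0 : ℂ)).add_const c
    have h2 : HasDerivAt (fun s : ℂ => s • μ) μ 0 := by
      simpa using (hasDerivAt_id (0 : ℂ)).smul_const μ
    have h3 := h2.add (h1.smul hd)
    have heq : oddPart x₀ φ =ᶠ[nhds 0] fun s => s • μ + (s ^ 2 + c) • oddPart x₀ ψ s := by
      filter_upwards [hV.mem_nhds hs] with t ht
      exact oddPart_eq_of_rec h ht
    have h4 := h3.congr_of_eventuallyEq heq
    rw [h4.deriv]
    simp
  · refine smul_right_injective E h0 ?_
    simp only
    rw [smul_dslope_oddPart, smul_add, smul_comm s, smul_dslope_oddPart, oddPart_eq_of_rec h hs]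

end Estimate

/-- The mean value of `|ρ sin θ| ^ (-1/2)`. -/
def sinMean (ρ : ℝ) : ℝ :=
  (2 * Real.pi)⁻¹ * ∫ θ in 0..2 * Real.pi, (√ρ)⁻¹ * (√|Real.sin θ|)⁻¹

theorem sinMean_nonneg (ρ : ℝ) : 0 ≤ sinMean ρ := by
  refine mul_nonneg (by positivity) ?_
  exact intervalIntegral.integral_nonneg Real.two_pi_pos.le fun _ _ => by positivity

theorem norm_lemniscate_coeff_le [CompleteSpace E] {D : Set ℂ} (hD : IsOpen D) {x₀ : ℂ} {y₀ ρ M : ℝ}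
    (hρ : 0 < ρ) (hsub : ∀ z : ℂ, ‖(z - x₀) ^ 2 + (y₀ : ℂ) ^ 2‖ ≤ ρ → z ∈ D) {φ : ℕ → ℂ → E}
    {κ μ : ℕ → E} (hφ : ∀ n, DifferentiableOn ℂ (φ n) D)
    (hrec : ∀ n, ∀ z ∈ D, φ n z = κ n + (z - x₀) • μ n +
      ((z - x₀) ^ 2 + (y₀ : ℂ) ^ 2) • φ (n + 1) z)
    (hM : ∀ z : ℂ, ‖(z - x₀) ^ 2 + (y₀ : ℂ) ^ 2‖ = ρ → ‖φ 0 z‖ ≤ M) (n : ℕ) :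
    ‖κ n‖ ≤ M / ρ ^ n ∧ ‖μ n‖ ≤ sinMean ρ * M / ρ ^ n := by
  set V : Set ℂ := {s | x₀ + s ∈ D ∧ x₀ - s ∈ D} with hVdef
  have hV : IsOpen V := isOpen_add_sub_mem hD
  have hVneg : ∀ s ∈ V, -s ∈ V := by
    rintro s ⟨h1, h2⟩
    exact ⟨by rwa [← sub_eq_add_neg], by rwa [sub_neg_eq_add]⟩
  -- The discontinuity of this root is harmless, because only even functions are composed with it.
  let r : ℂ → ℂ := fun w => (w - (y₀ : ℂ) ^ 2) ^ (2⁻¹ : ℂ)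
  have hr (w : ℂ) : r w ^ 2 + (y₀ : ℂ) ^ 2 = w := by
    simp only [r]
    rw [sq_cpow_half]; ring
  have hr1 (w : ℂ) : (x₀ + r w - x₀) ^ 2 + (y₀ : ℂ) ^ 2 = w := by
    rw [add_sub_cancel_left, hr]
  have hr2 (w : ℂ) : (x₀ - r w - x₀) ^ 2 + (y₀ : ℂ) ^ 2 = w := by
    rw [← hr w, hr w, sub_sub_cancel_left, neg_sq, hr]
  have hrV {w : ℂ} (hw : w ∈ Metric.closedBall (0 : ℂ) ρ) : r w ∈ V := by
    rw [mem_closedBall_zero_iff] at hw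
    exact ⟨hsub _ (by rwa [hr1]), hsub _ (by rwa [hr2])⟩
  have hdiff {e : ℂ → E} (he : DifferentiableOn ℂ e V) (heven : ∀ s, e (-s) = e s) :
      ∀ w ∈ Metric.closedBall (0 : ℂ) ρ, DifferentiableAt ℂ (fun w => e (r w)) w := by
    intro w hw
    exact DifferentiableAt.comp w (g := fun v => e (v ^ (2⁻¹ : ℂ)))
      (f := fun w : ℂ => w - (y₀ : ℂ) ^ 2)
      (differentiableAt_comp_cpow_half hV hVneg he heven (hrV hw)) (by fun_prop)
  have hφM (θ : ℝ) : ‖φ 0 (x₀ + r (circleMap 0 ρ θ))‖ ≤ M ∧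
      ‖φ 0 (x₀ - r (circleMap 0 ρ θ))‖ ≤ M := by
    have hn : ‖circleMap 0 ρ θ‖ = ρ := by rw [norm_circleMap_zero, abs_of_pos hρ]
    exact ⟨hM _ (by rw [hr1, hn]), hM _ (by rw [hr2, hn])⟩
  constructor
  · have h := norm_coeff_le (E := E) hρ (a := fun n w => evenPart x₀ (φ n) (r w)) (κ := κ)
      (fun n => hdiff (differentiableOn_evenPart (hφ n)) (evenPart_neg _ _))
      (fun n w hw => by
        have := evenPart_eq_of_rec (hrec n) (hrV hw)
        rwa [hr] at this)
      (B := fun _ => M) intervalIntegrable_const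
      (Filter.Eventually.of_forall fun θ => norm_evenPart_le (hφM θ).1 (hφM θ).2) n
    rw [intervalIntegral.integral_const, sub_zero, smul_eq_mul,
      inv_mul_cancel_left₀ Real.two_pi_pos.ne'] at h
    exact h
  · have hI : IntervalIntegrable (fun θ : ℝ => ((√ρ)⁻¹ * (√|Real.sin θ|)⁻¹) * M) volume 0
        (2 * Real.pi) := (intervalIntegrable_inv_sqrt_abs_sin.const_mul _).mul_const _
    have h := norm_coeff_le (E := E) hρ (a := fun n w => dslope (oddPart x₀ (φ n)) 0 (r w))
      (κ := μ) (fun n => hdiff (differentiableOn_dslope_oddPart hD (hφ n))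
        (dslope_oddPart_neg _ _))
      (fun n w hw => by
        have := dslope_oddPart_eq_of_rec hD (hφ (n + 1)) (hrec n) (hrV hw)
        rwa [hr] at this)
      hI (by
        filter_upwards [ae_sin_ne_zero] with θ hθ
        have hpos : 0 < √ρ * √|Real.sin θ| :=
          mul_pos (Real.sqrt_pos.2 hρ) (Real.sqrt_pos.2 (abs_pos.2 hθ))
        -- With `w` the point on the circle, `|r w|² = |w - y₀²| ≥ |Im w| = ρ |sin θ|`, as `y₀²` is
        -- real.
        have hle : √ρ * √|Real.sin θ| ≤ ‖r (circleMap 0 ρ θ)‖ := by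
          rw [← Real.sqrt_mul hρ.le]
          refine Real.sqrt_le_iff.2 ⟨norm_nonneg _, ?_⟩
          have e : r (circleMap 0 ρ θ) ^ 2 = circleMap 0 ρ θ - ((y₀ ^ 2 : ℝ) : ℂ) := by
            rw [eq_sub_iff_add_eq, ofReal_pow, hr]
          rw [← norm_pow, e]
          refine le_trans (le_of_eq ?_) (abs_im_le_norm _)
          rw [sub_im, ofReal_im, sub_zero]
          simp [circleMap_zero, exp_ofReal_mul_I_im, abs_mul, abs_of_pos hρ]
        have hO := norm_oddPart_le (hφM θ).1 (hφM θ).2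
        rw [← smul_dslope_oddPart, norm_smul] at hO
        rw [← mul_inv, ← div_eq_inv_mul, le_div_iff₀' hpos]
        exact (mul_le_mul_of_nonneg_right hle (norm_nonneg _)).trans hO) n
    rw [intervalIntegral.integral_mul_const, ← mul_assoc] at h
    exact h

end CoefficientEstimates

/-! ### The boundary of `U(x₀ + y₀ 𝕊, R)` -/

theorem norm_lemniscate_slicePoint {J : ℍ[ℝ]} (hJ : J ∈ imagUnits) (x₀ y₀ : ℝ) (z : ℂ) :
    ‖(slicePoint J z - (x₀ : ℍ[ℝ])) ^ 2 + (y₀ : ℍ[ℝ]) ^ 2‖ =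
      ‖(z - (x₀ : ℂ)) ^ 2 + (y₀ : ℂ) ^ 2‖ := by
  rw [← norm_slicePoint hJ ((z - (x₀ : ℂ)) ^ 2 + (y₀ : ℂ) ^ 2), ← slicePoint_ofReal J x₀,
    ← slicePoint_ofReal J y₀]
  have h (w : ℂ) : slicePoint J w = sliceHom ⟨J, hJ⟩ w := (sliceHom_apply ⟨J, hJ⟩ w).symm
  rw [h, h, h, h, map_add, map_pow, map_pow, map_sub]

/-- Shrink `w` to `(1 - δ) w` and take the roots `±s` of the corresponding equation. The distances
from `z - x₀` to `s` and `-s` have product `δ R² < ε²`, so one is below `ε`. This also covers the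
critical point `z = x₀`. -/
theorem exists_lemniscate_near {x₀ y₀ R ε : ℝ} (hR : 0 < R) (hε : 0 < ε) {z : ℂ}
    (hz : ‖(z - (x₀ : ℂ)) ^ 2 + (y₀ : ℂ) ^ 2‖ = R ^ 2) :
    ∃ z' : ℂ, ‖(z' - (x₀ : ℂ)) ^ 2 + (y₀ : ℂ) ^ 2‖ < R ^ 2 ∧ dist z z' < ε := by
  set w := (z - (x₀ : ℂ)) ^ 2 + (y₀ : ℂ) ^ 2 with hw
  have hR2 : 0 < R ^ 2 := by positivity
  set δ : ℝ := min (1 / 2) (ε ^ 2 / (2 * R ^ 2)) with hδ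
  have hδ0 : 0 < δ := lt_min (by norm_num) (by positivity)
  have hδ1 : δ ≤ 1 / 2 := min_le_left _ _
  have hδ2 : δ * R ^ 2 < ε ^ 2 := by
    have h1 : δ ≤ ε ^ 2 / (2 * R ^ 2) := min_le_right _ _
    rw [le_div_iff₀ (by positivity)] at h1
    nlinarith [sq_pos_of_pos hε]
  obtain ⟨s, hs⟩ : ∃ s : ℂ, s ^ 2 = (1 - δ : ℝ) * w - (y₀ : ℂ) ^ 2 := ⟨_, sq_cpow_half _⟩
  have hlt : ‖s ^ 2 + (y₀ : ℂ) ^ 2‖ < R ^ 2 := by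
    rw [hs, sub_add_cancel, norm_mul, hz, Complex.norm_real, Real.norm_of_nonneg (by linarith)]
    nlinarith
  have hprod : ‖z - x₀ - s‖ * ‖z - x₀ + s‖ = δ * R ^ 2 := by
    have e : (z - x₀ - s) * (z - x₀ + s) = (δ : ℂ) * w := by
      have h1 : (z - x₀ - s) * (z - x₀ + s) = (z - x₀) ^ 2 - s ^ 2 := by ring
      rw [h1, hs, hw]; push_cast; ring
    rw [← norm_mul, e, norm_mul, hz, Complex.norm_real, Real.norm_of_nonneg hδ0.le]
  by_cases hcase : ‖z - x₀ - s‖ < ε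
  · refine ⟨x₀ + s, by rwa [add_sub_cancel_left], ?_⟩
    rwa [dist_eq_norm, ← sub_sub]
  · refine ⟨x₀ - s, by rwa [sub_sub_cancel_left, neg_sq], ?_⟩
    rw [dist_eq_norm, ← sub_add]
    by_contra h
    push Not at h hcase
    nlinarith

theorem lemniscate_mem_closure {x₀ y₀ R : ℝ} (hR : 0 < R) {q : ℍ[ℝ]}
    (hq : ‖(q - (x₀ : ℍ[ℝ])) ^ 2 + (y₀ : ℍ[ℝ]) ^ 2‖ = R ^ 2) :
    q ∈ closure (lemniscateNhd x₀ y₀ R) := by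
  obtain ⟨J, hJ⟩ := exists_slicePoint_eq q
  set z : ℂ := ⟨q.re, ‖q.im‖⟩
  rw [← hJ] at hq ⊢
  rw [norm_lemniscate_slicePoint J.2] at hq
  have hz : z ∈ closure {z : ℂ | ‖(z - (x₀ : ℂ)) ^ 2 + (y₀ : ℂ) ^ 2‖ < R ^ 2} :=
    Metric.mem_closure_iff.2 fun _ hε => exists_lemniscate_near hR hε hq
  refine map_mem_closure (continuous_slicePoint J) hz fun z hz => ?_
  change ‖(slicePoint J z - (x₀ : ℍ[ℝ])) ^ 2 + (y₀ : ℍ[ℝ]) ^ 2‖ < R ^ 2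
  rw [norm_lemniscate_slicePoint J.2]
  exact hz

/-- The Cauchy estimate needs a bound on the whole level set, so the inclusion of the level set in
the frontier is essential. -/
theorem frontier_lemniscateNhd {x₀ y₀ R : ℝ} (hR : 0 < R) :
    frontier (lemniscateNhd x₀ y₀ R) =
      {q | ‖(q - (x₀ : ℍ[ℝ])) ^ 2 + (y₀ : ℍ[ℝ]) ^ 2‖ = R ^ 2} := by
  have hc : Continuous fun q : ℍ[ℝ] => ‖(q - (x₀ : ℍ[ℝ])) ^ 2 + (y₀ : ℍ[ℝ]) ^ 2‖ := by fun_prop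
  refine (frontier_lt_subset_eq hc continuous_const).antisymm fun q hq => ?_
  have ho : IsOpen (lemniscateNhd x₀ y₀ R) := isOpen_lt hc continuous_const
  change q ∈ frontier (lemniscateNhd x₀ y₀ R)
  rw [ho.frontier_eq]
  exact ⟨lemniscate_mem_closure hR hq, fun h => (ne_of_lt h) hq⟩

theorem lemniscate_subset {x₀ y₀ R : ℝ} (hR : 0 < R) {Ω : Set ℍ[ℝ]}
    (h : closure (lemniscateNhd x₀ y₀ R) ⊆ Ω) {J : ℍ[ℝ]} (hJ : J ∈ imagUnits) {z : ℂ}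
    (hz : ‖(z - (x₀ : ℂ)) ^ 2 + (y₀ : ℂ) ^ 2‖ ≤ R ^ 2) : slicePoint J z ∈ Ω := by
  rw [← norm_lemniscate_slicePoint hJ] at hz
  rcases hz.lt_or_eq with hlt | heq
  · exact h (subset_closure hlt)
  · exact h (lemniscate_mem_closure hR heq)

theorem isCompact_imagUnits : IsCompact imagUnits := by
  refine Metric.isCompact_of_isClosed_isBounded ?_ ?_
  · exact isClosed_eq (by fun_prop) continuous_const
  · refine (Metric.isBounded_closedBall (x := (0 : ℍ[ℝ])) (r := 1)).subset fun I hI => ?_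
    rw [mem_closedBall_zero_iff, norm_imagUnits hI]

theorem isCompact_lemniscate (x₀ y₀ R : ℝ) :
    IsCompact {z : ℂ | ‖(z - (x₀ : ℂ)) ^ 2 + (y₀ : ℂ) ^ 2‖ = R ^ 2} := by
  refine Metric.isCompact_of_isClosed_isBounded ?_ ?_
  · exact isClosed_eq (by fun_prop) continuous_const
  · refine (Metric.isBounded_closedBall (x := (x₀ : ℂ)) (r := R ^ 2 + y₀ ^ 2 + 1)).subset
      fun z hz => ?_
    rw [mem_closedBall_iff_norm]
    have h1 := norm_sub_norm_le ((z - (x₀ : ℂ)) ^ 2) (-(y₀ : ℂ) ^ 2)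
    have h2 : ‖(z - (x₀ : ℂ)) ^ 2 - -(y₀ : ℂ) ^ 2‖ = R ^ 2 := by
      rw [sub_neg_eq_add]; exact hz
    rw [h2, norm_neg, norm_pow, norm_pow, Complex.norm_real, Real.norm_eq_abs, sq_abs] at h1
    nlinarith [norm_nonneg (z - (x₀ : ℂ))]

/-- Continuity of `f` is assumed only along slices. The representation formula makes `f` a
continuous function of `(J, z)` on the compact set `imagUnits ×ˢ K`, which parametrizes the
frontier. -/
theorem exists_isGreatest_frontier {x₀ y₀ R : ℝ} (hR : 0 < R) {Ω : Set ℍ[ℝ]} {f : ℍ[ℝ] → ℍ[ℝ]}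
    (hΩ : IsSymmetricSliceDomain Ω) (hf : IsRegularOn f Ω)
    (hU : closure (lemniscateNhd x₀ y₀ R) ⊆ Ω) :
    ∃ M : ℝ, IsGreatest ((fun q => ‖f q‖) '' frontier (lemniscateNhd x₀ y₀ R)) M := by
  let I : imagUnits := ⟨stdUnit, stdUnit_mem⟩
  set K : Set ℂ := {z : ℂ | ‖(z - (x₀ : ℂ)) ^ 2 + (y₀ : ℂ) ^ 2‖ = R ^ 2} with hK
  have hKΩ {J : ℍ[ℝ]} (hJ : J ∈ imagUnits) {z : ℂ} (hz : z ∈ K) : slicePoint J z ∈ Ω :=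
    lemniscate_subset hR hU hJ (le_of_eq hz)
  have hKf {J : ℍ[ℝ]} (hJ : J ∈ imagUnits) {z : ℂ} :
      slicePoint J z ∈ frontier (lemniscateNhd x₀ y₀ R) ↔ z ∈ K := by
    rw [frontier_lemniscateNhd hR, Set.mem_ofPred_eq, norm_lemniscate_slicePoint hJ]
    rfl
  have hcont {z : ℂ} (hz : slicePoint I z ∈ Ω) :
      ContinuousAt (fun w => f (slicePoint I w)) z :=
    (hf I I.2 z hz).1.continuousAt
  have hF : ContinuousOn (fun v : ℍ[ℝ] × ℂ => ‖extendValue I v.1 (f (slicePoint I v.2))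
      (f (slicePoint I (star v.2)))‖) (imagUnits ×ˢ K) := by
    rintro ⟨J, z⟩ ⟨-, hz⟩
    have h1 : ContinuousAt (fun v : ℍ[ℝ] × ℂ => f (slicePoint I v.2)) (J, z) :=
      ContinuousAt.comp (f := fun v : ℍ[ℝ] × ℂ => v.2) (hcont (hKΩ I.2 hz)) continuousAt_snd
    have h2 : ContinuousAt (fun v : ℍ[ℝ] × ℂ => f (slicePoint I (star v.2))) (J, z) :=
      ContinuousAt.comp (f := fun v : ℍ[ℝ] × ℂ => star v.2) (g := fun w => f (slicePoint I w))
        (hcont (hΩ.symmetric.star_mem I.2 (hKΩ I.2 hz))) continuous_snd.star.continuousAt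
    have h3 : ContinuousAt (fun v : ℍ[ℝ] × ℂ => v.1 * (I : ℍ[ℝ])) (J, z) := by fun_prop
    exact (((((continuousAt_const.sub h3).mul h1).add
      ((continuousAt_const.add h3).mul h2)).const_smul (1 / 2 : ℝ)).norm).continuousWithinAt
  have hne : (imagUnits ×ˢ K).Nonempty := by
    refine ⟨(I, x₀ + ((R ^ 2 : ℂ) - (y₀ : ℂ) ^ 2) ^ (2⁻¹ : ℂ)), I.2, ?_⟩
    change ‖_‖ = _
    rw [add_sub_cancel_left, sq_cpow_half, sub_add_cancel, norm_pow, Complex.norm_real,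
      Real.norm_eq_abs, sq_abs]
  obtain ⟨⟨J, z⟩, ⟨hJ, hz⟩, hmax⟩ :=
    (isCompact_imagUnits.prod (isCompact_lemniscate x₀ y₀ R)).exists_isMaxOn hne hF
  have hrep {J : ℍ[ℝ]} (hJ : J ∈ imagUnits) {z : ℂ} (hz : z ∈ K) :
      f (slicePoint J z) = extendValue I J (f (slicePoint I z)) (f (slicePoint I (star z))) :=
    hf.slicePoint_eq hΩ I ⟨J, hJ⟩ (hKΩ I.2 hz)
  refine ⟨‖f (slicePoint J z)‖, ⟨_, (hKf hJ).2 hz, rfl⟩, ?_⟩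
  rintro _ ⟨q, hq, rfl⟩
  obtain ⟨J', hJ'⟩ := exists_slicePoint_eq q
  set z' : ℂ := ⟨q.re, ‖q.im‖⟩
  rw [← hJ', hKf J'.2] at hq
  have := hmax (Set.mk_mem_prod J'.2 hq)
  simp only [Set.mem_ofPred_eq] at this
  rw [← hrep J'.2 hq, ← hrep hJ hz, hJ'] at this
  exact this

/-! ### The coefficients of the expansion -/

theorem coeff_two_mul (Ω : Set ℍ[ℝ]) (p : ℍ[ℝ]) (f : ℍ[ℝ] → ℍ[ℝ]) (k : ℕ) :
    coeff Ω p f (2 * k) = remainderIter Ω p f k p := by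
  rw [coeff, if_pos (even_two_mul k), Nat.mul_div_cancel_left k two_pos]

theorem coeff_two_mul_add_one (Ω : Set ℍ[ℝ]) (p : ℍ[ℝ]) (f : ℍ[ℝ] → ℍ[ℝ]) (k : ℕ) :
    coeff Ω p f (2 * k + 1) = remainder Ω p (remainderIter Ω p f k) (star p) := by
  have h : (2 * k + 1) / 2 = k := by omega
  rw [coeff, if_neg (by simp), h]

theorem restrict_remainderIter {Ω : Set ℍ[ℝ]} (hΩ : IsSymmetricSliceDomain Ω) {f : ℍ[ℝ] → ℍ[ℝ]}
    (hf : IsRegularOn f Ω) (I : imagUnits) {z₀ z : ℂ} (hz₀ : slicePoint I z₀ ∈ Ω)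
    (hz : slicePoint I z ∈ Ω) (n : ℕ) :
    restrict I (remainderIter Ω (slicePoint I z₀) f n) z =
      LeftSlice.mk I (coeff Ω (slicePoint I z₀) f (2 * n)) +
      (z - z₀) • LeftSlice.mk I (coeff Ω (slicePoint I z₀) f (2 * n + 1)) +
      ((z - z₀) * (z - star z₀)) •
        restrict I (remainderIter Ω (slicePoint I z₀) f (n + 1)) z := by
  have h1 := isRemainder_remainder hΩ (isRegularOn_remainderIter hΩ hf I hz₀ n) I hz₀
  have h2 := isRemainder_remainder hΩ h1.1 I (hΩ.symmetric.star_mem I.2 hz₀)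
  rw [h1.restrict_eq hz, h2.restrict_eq hz, coeff_two_mul, coeff_two_mul_add_one,
    remainderIter_succ, star_slicePoint I.2, smul_add, smul_smul, ← add_assoc]
  rfl

theorem norm_coeff_le_of_frontier {x₀ y₀ R M : ℝ} (hR : 0 < R) {Ω : Set ℍ[ℝ]}
    {f : ℍ[ℝ] → ℍ[ℝ]} (hΩ : IsSymmetricSliceDomain Ω) (hf : IsRegularOn f Ω)
    (hU : closure (lemniscateNhd x₀ y₀ R) ⊆ Ω) (I : imagUnits) (hz₀ : slicePoint I ⟨x₀, y₀⟩ ∈ Ω)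
    (hM : ∀ q ∈ frontier (lemniscateNhd x₀ y₀ R), ‖f q‖ ≤ M) (k : ℕ) :
    ‖coeff Ω (slicePoint I ⟨x₀, y₀⟩) f (2 * k)‖ ≤
        (1 + |y₀| * sinMean (R ^ 2)) * M / (R ^ 2) ^ k ∧
      ‖coeff Ω (slicePoint I ⟨x₀, y₀⟩) f (2 * k + 1)‖ ≤ sinMean (R ^ 2) * M / (R ^ 2) ^ k := by
  set z₀ : ℂ := ⟨x₀, y₀⟩ with hz₀def
  set p := slicePoint I z₀
  have hz₀' : z₀ = x₀ + y₀ * Complex.I := Complex.mk_eq_add_mul_I _ _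
  have hst : star z₀ = x₀ - y₀ * Complex.I := by
    rw [hz₀']
    simp [sub_eq_add_neg]
  have hφ (n : ℕ) : DifferentiableOn ℂ (restrict I (remainderIter Ω p f n))
      (slicePoint I ⁻¹' Ω) := fun z hz =>
    (isRegularOn_iff.1 (isRegularOn_remainderIter hΩ hf I hz₀ n) I z hz).differentiableWithinAt
  have h := norm_lemniscate_coeff_le (hΩ.isOpen.preimage (continuous_slicePoint I)) (x₀ := x₀)
    (y₀ := y₀) (sq_pos_of_pos hR) (fun z hz => lemniscate_subset hR hU I.2 hz) hφ
    -- Recentring at `x₀` by `z - z₀ = (z - x₀) - y₀ I` moves `-y₀ I A₂ₙ₊₁` into the constant term.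
    (κ := fun n => LeftSlice.mk I (coeff Ω p f (2 * n)) -
      (y₀ * Complex.I) • LeftSlice.mk I (coeff Ω p f (2 * n + 1)))
    (μ := fun n => LeftSlice.mk I (coeff Ω p f (2 * n + 1)))
    (fun n z hz => by
      have e : (z - z₀) * (z - star z₀) = (z - x₀) ^ 2 + (y₀ : ℂ) ^ 2 := by
        rw [hst, hz₀']
        linear_combination (-(y₀ : ℂ) ^ 2) * Complex.I_sq
      have e' : z - z₀ = (z - x₀) - y₀ * Complex.I := by rw [hz₀']; ring
      have hn := restrict_remainderIter hΩ hf I hz₀ hz n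
      rw [e, e', sub_smul] at hn
      refine hn.trans ?_
      abel)
    (M := M) (fun z hz => by
      refine hM (slicePoint I z) ?_
      rw [frontier_lemniscateNhd hR, Set.mem_ofPred_eq, norm_lemniscate_slicePoint I.2]
      exact hz) k
  refine ⟨?_, h.2⟩
  have hk := norm_add_le (LeftSlice.mk I (coeff Ω p f (2 * k)) -
    (y₀ * Complex.I) • LeftSlice.mk I (coeff Ω p f (2 * k + 1)))
    ((y₀ * Complex.I) • LeftSlice.mk I (coeff Ω p f (2 * k + 1)))
  rw [sub_add_cancel, norm_smul ((y₀ : ℂ) * Complex.I), norm_mul, Complex.norm_I,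
    Complex.norm_real, Real.norm_eq_abs, mul_one] at hk
  refine hk.trans ((add_le_add h.1 (mul_le_mul_of_nonneg_left h.2 (abs_nonneg y₀))).trans
    (le_of_eq ?_))
  ring

end SliceRegular

end

/-! ### Assembly of the coefficient bound -/

theorem mainTheorem4 (x₀ y₀ R : ℝ) (hR : 0 < R) :
    ∃ C : ℝ, 0 < C ∧
      ∀ (Ω : Set ℍ[ℝ]) (f : ℍ[ℝ] → ℍ[ℝ]) (q₀ : ℍ[ℝ]),
        SliceRegular.IsSymmetricSliceDomain Ω →
        SliceRegular.IsRegularOn f Ω →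
        SliceRegular.unitSphere x₀ y₀ ⊆ Ω →
        q₀ ∈ SliceRegular.unitSphere x₀ y₀ →
        closure (SliceRegular.lemniscateNhd x₀ y₀ R) ⊆ Ω →
        -- the functions in the definition of the coefficients exist
        (∀ n : ℕ,
          SliceRegular.IsRemainder Ω q₀ (SliceRegular.remainderIter Ω q₀ f n)
            (SliceRegular.remainder Ω q₀ (SliceRegular.remainderIter Ω q₀ f n)) ∧
          SliceRegular.IsRemainder Ω (star q₀)
            (SliceRegular.remainder Ω q₀ (SliceRegular.remainderIter Ω q₀ f n))
            (SliceRegular.remainderIter Ω q₀ f (n + 1))) ∧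
        ∃ M : ℝ,
          IsGreatest ((fun q => ‖f q‖) '' frontier (SliceRegular.lemniscateNhd x₀ y₀ R)) M ∧
          ∀ n : ℕ, ‖SliceRegular.coeff Ω q₀ f n‖ ≤ C * (M / R ^ n) := by
  have hK := SliceRegular.sinMean_nonneg (R ^ 2)
  set K := SliceRegular.sinMean (R ^ 2) with hKdef
  have hyK : 0 ≤ |y₀| * K := by positivity
  have hRK : 0 ≤ K * R := by positivity
  -- Even indices need `1 + |y₀| K`; odd ones need `K R`, the factor `R` turning `R ^ (2k)` into `R
  -- ^ (2k + 1)`.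
  refine ⟨1 + |y₀| * K + K * R, by positivity, ?_⟩
  intro Ω f q₀ hΩ hf hS hq₀ hU
  obtain ⟨I, rfl⟩ : ∃ I : SliceRegular.imagUnits, q₀ = SliceRegular.slicePoint I ⟨x₀, y₀⟩ := by
    obtain ⟨I, hI, h⟩ := hq₀
    exact ⟨⟨I, hI⟩, h⟩
  have hz₀ : SliceRegular.slicePoint I ⟨x₀, y₀⟩ ∈ Ω := hS hq₀
  refine ⟨fun n => ?_, ?_⟩
  · have h1 := SliceRegular.isRemainder_remainder hΩ
      (SliceRegular.isRegularOn_remainderIter hΩ hf I hz₀ n) I hz₀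
    refine ⟨h1, ?_⟩
    rw [SliceRegular.remainderIter_succ, SliceRegular.star_slicePoint I.2]
    exact SliceRegular.isRemainder_remainder hΩ h1.1 I (hΩ.symmetric.star_mem I.2 hz₀)
  · obtain ⟨M, hM⟩ := SliceRegular.exists_isGreatest_frontier hR hΩ hf hU
    refine ⟨M, hM, fun n => ?_⟩
    have hM0 : 0 ≤ M := by
      obtain ⟨q, -, hq⟩ := hM.1
      rw [← hq]; exact norm_nonneg _
    have key := SliceRegular.norm_coeff_le_of_frontier hR hΩ hf hU I hz₀
      (fun q hq => hM.2 ⟨q, hq, rfl⟩) (n / 2)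
    rw [← hKdef, ← pow_mul] at key
    rcases Nat.even_or_odd' n with ⟨k, rfl | rfl⟩
    · rw [Nat.mul_div_cancel_left k two_pos] at key
      refine key.1.trans ?_
      rw [mul_div_assoc]
      refine mul_le_mul_of_nonneg_right ?_ (by positivity)
      linarith
    · have h : (2 * k + 1) / 2 = k := by omega
      rw [h] at key
      refine key.2.trans ?_
      have e : K * M / R ^ (2 * k) = (K * R) * (M / R ^ (2 * k + 1)) := by
        rw [pow_succ]; field_simp
      rw [e]
      refine mul_le_mul_of_nonneg_right ?_ (by positivity)
      linarith
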